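/- Let the standard cubulation of $\mathbb R^4$ be the cell structure whose cells are the unit cubes with vertices in $\mathbb Z^4$ and all their faces, and let $X$ be its 2-skeleton. Regard $S^4$ as $\mathbb R^4\cup\{\infty\}$ and let $\mathrm{Mob}(S^4)$ be the group generated by the inversions in round spheres, with the topology of uniform convergence. For a subcomplex $K$, let the barycentric subdivision $\beta(K)$ be the geometric simplicial complex obtained by subdividing each edge of $K$ by its midpoint and then, inductively, each $k$-cube $Q$ of $K$ by coning off the subdivision of $\partial Q$ from the center of $Q$; that is, the simplices of $\beta(K)$ are the convex hulls of the sets of centers of the cells in the nonempty finite chains $C_0\subset\dots\subset C_p$ of cells of $K$. The nerve of a family of open balls $(B_i)_{i\in I}$ is the abstract simplicial complex on $I$ whose simplices are the nonempty finite sets $s\subset I$ with $\bigcap_{i\in s}B_i\neq\emptyset$; its canonical map to $\mathbb R^4$ sends the vertex $i$ to the center of $B_i$ and is linear on simplices. For a group $G\subset\mathrm{Mob}(S^4)$, the domain of discontinuity $\Omega(G)$ is the set of points that have a neighborhood $U$ with $gU\cap U\ne\emptyset$ for only finitely many $g\in G$; a fundamental domain of $G$ is a set $\Phi\subset S^4$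 that is the closure of its interior, such that $g(\operatorname{int}\Phi)\cap\operatorname{int}\Phi=\emptyset$ for all $g\in G\setminus\{1\}$, the translates $g\Phi$, $g\in G$, cover $\Omega(G)$, and every point of $\Omega(G)$ has a neighborhood that meets $g\Phi$ for only finitely many $g\in G$. **Proposition.** Let $K\subset X$ be a compact 2-dimensional subcomplex such that each vertex of $K$ belongs to a 2-cell of $K$. Then there is a finite collection of open round 4-balls $B_1,\dots,B_k$ (of positive radii), centered at the vertices of $\beta(K)$, such that: 1. The inversions $R_i$ in the round spheres $\partial B_i$ generate a discrete reflection group $G\subset\mathrm{Mob}(S^4)$. 2. The complement $\Phi=S^4\setminus\bigcup_{i=1}^k B_i$ is a fundamental domain of $G$. 3. The canonical map from the nerve of $\{B_1,\dots,B_k\}$ to $\mathbb R^4$ is a simplicial isomorphism onto $\beta(K)$: it is a bijection from the vertices of the nerve to those of $\beta(K)$ under which the simplices of the two complexes correspond to each other, and it maps the geometric realization of the nerve bijectively onto the underlying space of $\beta(K)$. -/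

import Mathlib

open Set Filter Topology

/-! ### Cells of the standard cubulation, subcomplexes, barycentric subdivision -/

/-- A (closed, nonempty) cell of the standard cubulation of `ℝⁿ` by unit cubes, given by its
lexicographically smallest vertex `base ∈ ℤⁿ` and by the set `dirs` of the coordinate directions in
which it extends. -/
@[ext]
structure GridCell (n : ℕ) where
  base : Fin n → ℤ
  dirs : Finset (Fin n)

namespace GridCell

variable {n : ℕ}

/-- The closed cell as a subset of `ℝⁿ`: a product of the intervals `[aⱼ, aⱼ + 1]` for the free
directions `j` and of the points `aⱼ` for the other directions. -/
def carrier (C : GridCell n) : Set (EuclideanSpace ℝ (Fin n)) :=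
  {x | (∀ j ∈ C.dirs, x j ∈ Icc (C.base j : ℝ) (C.base j + 1)) ∧
    ∀ j ∉ C.dirs, x j = C.base j}

/-- The dimension of a cell. -/
def dim (C : GridCell n) : ℕ := C.dirs.card

/-- `C.IsFace D`: the closed cell `C` is a face of the closed cell `D` (possibly `C = D`). -/
def IsFace (C D : GridCell n) : Prop := C.carrier ⊆ D.carrier

/-- The center (barycenter) of a cell. -/
noncomputable def center (C : GridCell n) : EuclideanSpace ℝ (Fin n) :=
  WithLp.toLp 2 fun j => (C.base j : ℝ) + if j ∈ C.dirs then 1 / 2 else 0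

theorem center_apply (C : GridCell n) (j : Fin n) :
    C.center j = (C.base j : ℝ) + if j ∈ C.dirs then 1 / 2 else 0 := rfl

theorem center_mem_carrier (C : GridCell n) : C.center ∈ C.carrier := by
  refine ⟨fun j hj => ?_, fun j hj => ?_⟩
  · rw [center_apply, if_pos hj]
    constructor <;> linarith
  · rw [center_apply, if_neg hj, add_zero]

/-- A cell is determined by a point of its open cell (here in a scaled form). -/
theorem eq_of_mem_openCell {C D : GridCell n} {L : ℝ} (hL : 0 < L) {x : Fin n → ℝ}
    (hC : ∀ j ∈ C.dirs, L * C.base j < x j ∧ x j < L * (C.base j + 1))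
    (hC' : ∀ j ∉ C.dirs, x j = L * C.base j)
    (hD : ∀ j ∈ D.dirs, L * D.base j < x j ∧ x j < L * (D.base j + 1))
    (hD' : ∀ j ∉ D.dirs, x j = L * D.base j) : C = D := by
  have key : ∀ a b : ℤ, L * (a : ℝ) < L * ((b : ℝ) + 1) → a ≤ b := by
    intro a b h
    have h1 : (a : ℝ) < (b : ℝ) + 1 := lt_of_mul_lt_mul_left h hL.le
    have h2 : a < b + 1 := by exact_mod_cast h1
    omega
  have key' : ∀ a b : ℤ, L * (a : ℝ) < L * (b : ℝ) → a < b := by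
    intro a b h
    have h1 : (a : ℝ) < (b : ℝ) := lt_of_mul_lt_mul_left h hL.le
    exact_mod_cast h1
  have step : ∀ j, C.base j = D.base j ∧ (j ∈ C.dirs ↔ j ∈ D.dirs) := by
    intro j
    have exp1 : ∀ a : ℤ, L * (a : ℝ) < L * ((a : ℝ) + 1) := fun a => by nlinarith
    by_cases h1 : j ∈ C.dirs <;> by_cases h2 : j ∈ D.dirs
    · have a := key _ _ ((hC j h1).1.trans (hD j h2).2)
      have b := key _ _ ((hD j h2).1.trans (hC j h1).2)
      exact ⟨le_antisymm a b, by simp [h1, h2]⟩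
    · exfalso
      have e := hD' j h2
      have a := hC j h1
      rw [e] at a
      have b := key' _ _ a.1
      have c := key _ _ a.2
      omega
    · exfalso
      have e := hC' j h1
      have a := hD j h2
      rw [e] at a
      have b := key' _ _ a.1
      have c := key _ _ a.2
      omega
    · have e : L * (C.base j : ℝ) = L * (D.base j : ℝ) := (hC' j h1).symm.trans (hD' j h2)
      have e' : (C.base j : ℝ) = (D.base j : ℝ) := mul_left_cancel₀ hL.ne' e
      exact ⟨by exact_mod_cast e', by simp [h1, h2]⟩
  ext j
  · exact (step j).1
  · exact (step j).2

theorem center_injective : Function.Injective (center (n := n)) := by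
  intro C D h
  have hx : ∀ E : GridCell n, (∀ j ∈ E.dirs, 1 * (E.base j : ℝ) < E.center j ∧
      E.center j < 1 * ((E.base j : ℝ) + 1)) ∧ ∀ j ∉ E.dirs, E.center j = 1 * (E.base j : ℝ) := by
    intro E
    refine ⟨fun j hj => ?_, fun j hj => ?_⟩
    · rw [center_apply, if_pos hj]
      constructor <;> linarith
    · rw [center_apply, if_neg hj]
      ring
  refine eq_of_mem_openCell (x := fun j => C.center j) one_pos (hx C).1 (hx C).2 ?_ ?_
  · rw [h]
    exact (hx D).1
  · rw [h]
    exact (hx D).2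

/-- The centers of cells, as an embedding. -/
noncomputable def centerEmb : GridCell n ↪ EuclideanSpace ℝ (Fin n) := ⟨center, center_injective⟩

/-- The largest cell of a chain with nonnegative weights: the weighted sum of the centers lies in
the (scaled) open cell. -/
theorem exists_top (S : Finset (GridCell n)) (w : GridCell n → ℝ) (hw : ∀ C ∈ S, 0 ≤ w C)
    (hc : IsChain IsFace {C | C ∈ S ∧ w C ≠ 0}) (hpos : 0 < ∑ C ∈ S, w C) :
    ∃ C ∈ S, w C ≠ 0 ∧
      (∀ j ∈ C.dirs, (∑ D ∈ S, w D) * (C.base j : ℝ) < ∑ D ∈ S, w D * D.center j ∧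
        ∑ D ∈ S, w D * D.center j < (∑ D ∈ S, w D) * ((C.base j : ℝ) + 1)) ∧
      ∀ j ∉ C.dirs, ∑ D ∈ S, w D * D.center j = (∑ D ∈ S, w D) * (C.base j : ℝ) := by
  classical
  have hne : (S.filter fun C => w C ≠ 0).Nonempty := by
    by_contra h
    rw [Finset.not_nonempty_iff_eq_empty, Finset.filter_eq_empty_iff] at h
    push Not at h
    rw [Finset.sum_eq_zero h] at hpos
    exact lt_irrefl _ hpos
  obtain ⟨C, hCm, hmax⟩ := Finset.exists_maximalFor carrier _ hne
  have hCS := (Finset.mem_filter.1 hCm).1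
  have hCw := (Finset.mem_filter.1 hCm).2
  have htop : ∀ D ∈ S, w D ≠ 0 → D.center ∈ C.carrier := by
    intro D hD hDw
    have hDm : D ∈ S.filter fun C => w C ≠ 0 := Finset.mem_filter.2 ⟨hD, hDw⟩
    have : D.carrier ⊆ C.carrier := by
      rcases eq_or_ne D C with rfl | hDC
      · exact subset_rfl
      · rcases hc (show D ∈ {C | C ∈ S ∧ w C ≠ 0} from ⟨hD, hDw⟩)
          (show C ∈ {C | C ∈ S ∧ w C ≠ 0} from ⟨hCS, hCw⟩) hDC with h | h
        · exact h
        · exact hmax hDm h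
    exact this D.center_mem_carrier
  have hCpos : 0 < w C := lt_of_le_of_ne (hw C hCS) (Ne.symm hCw)
  refine ⟨C, hCS, hCw, fun j hj => ⟨?_, ?_⟩, fun j hj => ?_⟩
  · rw [Finset.sum_mul]
    refine Finset.sum_lt_sum (fun D hD => ?_) ⟨C, hCS, ?_⟩
    · rcases eq_or_ne (w D) 0 with h | h
      · simp [h]
      · exact mul_le_mul_of_nonneg_left (((htop D hD h).1 j hj).1) (hw D hD)
    · refine mul_lt_mul_of_pos_left ?_ hCpos
      rw [center_apply, if_pos hj]
      linarith
  · rw [Finset.sum_mul]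
    refine Finset.sum_lt_sum (fun D hD => ?_) ⟨C, hCS, ?_⟩
    · rcases eq_or_ne (w D) 0 with h | h
      · simp [h]
      · exact mul_le_mul_of_nonneg_left (((htop D hD h).1 j hj).2) (hw D hD)
    · refine mul_lt_mul_of_pos_left ?_ hCpos
      rw [center_apply, if_pos hj]
      linarith
  · rw [Finset.sum_mul]
    refine Finset.sum_congr rfl fun D hD => ?_
    rcases eq_or_ne (w D) 0 with h | h
    · simp [h]
    · rw [(htop D hD h).2 j hj]

/-- Uniqueness of barycentric coordinates with respect to chains of cells. -/
theorem weights_unique (S : Finset (GridCell n)) (m : ℕ) : ∀ w v : GridCell n → ℝ,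
    (∀ C ∈ S, 0 ≤ w C) → (∀ C ∈ S, 0 ≤ v C) →
    IsChain IsFace {C | C ∈ S ∧ w C ≠ 0} → IsChain IsFace {C | C ∈ S ∧ v C ≠ 0} →
    ∑ C ∈ S, w C = ∑ C ∈ S, v C →
    (∀ j, ∑ C ∈ S, w C * C.center j = ∑ C ∈ S, v C * C.center j) →
    {C | C ∈ S ∧ w C ≠ 0}.ncard + {C | C ∈ S ∧ v C ≠ 0}.ncard ≤ m →
    ∀ C ∈ S, w C = v C := by
  classical
  induction m using Nat.strong_induction_on with
  | _ m ih =>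
    -- the case in which the weight of `w` at the top cell is the smaller one
    have main : ∀ w v : GridCell n → ℝ,
        (∀ C ∈ S, 0 ≤ w C) → (∀ C ∈ S, 0 ≤ v C) →
        IsChain IsFace {C | C ∈ S ∧ w C ≠ 0} → IsChain IsFace {C | C ∈ S ∧ v C ≠ 0} →
        ∑ C ∈ S, w C = ∑ C ∈ S, v C →
        (∀ j, ∑ C ∈ S, w C * C.center j = ∑ C ∈ S, v C * C.center j) →
        {C | C ∈ S ∧ w C ≠ 0}.ncard + {C | C ∈ S ∧ v C ≠ 0}.ncard ≤ m →
        ∀ T ∈ S, w T ≠ 0 → v T ≠ 0 → w T ≤ v T → ∀ C ∈ S, w C = v C := by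
      intro w v hw hv cw cv hs hc hm T hT hwT hvT hle
      let w' : GridCell n → ℝ := fun C => if C = T then 0 else w C
      let v' : GridCell n → ℝ := fun C => if C = T then v T - w T else v C
      have ew : ∀ C, w' C = w C - if C = T then w T else 0 := by
        intro C
        by_cases h : C = T
        · simp [w', h]
        · simp [w', h]
      have ev : ∀ C, v' C = v C - if C = T then w T else 0 := by
        intro C
        by_cases h : C = T
        · simp [v', h]
        · simp [v', h]
      have subw : {C | C ∈ S ∧ w' C ≠ 0} ⊆ {C | C ∈ S ∧ w C ≠ 0} := by
        rintro C ⟨h1, h2⟩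
        refine ⟨h1, ?_⟩
        by_cases h : C = T
        · simp [w', h] at h2
        · simpa [w', h] using h2
      have subv : {C | C ∈ S ∧ v' C ≠ 0} ⊆ {C | C ∈ S ∧ v C ≠ 0} := by
        rintro C ⟨h1, h2⟩
        refine ⟨h1, ?_⟩
        by_cases h : C = T
        · rw [h]
          exact hvT
        · simpa [v', h] using h2
      have fw : {C | C ∈ S ∧ w C ≠ 0}.Finite := S.finite_toSet.subset fun C h => h.1
      have fv : {C | C ∈ S ∧ v C ≠ 0}.Finite := S.finite_toSet.subset fun C h => h.1
      have lt1 : {C | C ∈ S ∧ w' C ≠ 0}.ncard < {C | C ∈ S ∧ w C ≠ 0}.ncard := by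
        refine Set.ncard_lt_ncard ((Set.ssubset_iff_of_subset subw).2 ⟨T, ⟨hT, hwT⟩, ?_⟩) fw
        rintro ⟨-, h⟩
        exact h (by simp [w'])
      have le2 : {C | C ∈ S ∧ v' C ≠ 0}.ncard ≤ {C | C ∈ S ∧ v C ≠ 0}.ncard :=
        Set.ncard_le_ncard subv fv
      have res := ih _ (by omega) w' v' ?_ ?_ (cw.mono subw) (cv.mono subv) ?_ ?_ le_rfl
      · intro C hC
        have := res C hC
        rw [ew, ev] at this
        linarith
      · intro C hC
        by_cases h : C = T
        · simp [w', h]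
        · simpa [w', h] using hw C hC
      · intro C hC
        by_cases h : C = T
        · simpa [v', h] using hle
        · simpa [v', h] using hv C hC
      · simp only [ew, ev, Finset.sum_sub_distrib, hs]
      · intro j
        simp only [ew, ev, sub_mul, Finset.sum_sub_distrib, hc j]
    intro w v hw hv cw cv hs hc hm
    rcases (Finset.sum_nonneg hw).eq_or_lt with h0 | hpos
    · have h1 := (Finset.sum_eq_zero_iff_of_nonneg hw).1 h0.symm
      have h2 := (Finset.sum_eq_zero_iff_of_nonneg hv).1 (hs ▸ h0.symm)
      intro C hC
      rw [h1 C hC, h2 C hC]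
    · obtain ⟨T, hT, hwT, a1, a2⟩ := exists_top S w hw cw hpos
      obtain ⟨T', hT', hvT, b1, b2⟩ := exists_top S v hv cv (hs ▸ hpos)
      have hTT : T = T' := by
        refine eq_of_mem_openCell (x := fun j => ∑ D ∈ S, w D * D.center j) hpos a1 a2 ?_ ?_
        · intro j hj
          have := b1 j hj
          rw [← hs, ← hc j] at this
          exact this
        · intro j hj
          have := b2 j hj
          rw [← hs, ← hc j] at this
          exact this
      subst hTT
      rcases le_total (w T) (v T) with hle | hle
      · exact main w v hw hv cw cv hs hc hm T hT hwT hvT hle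
      · intro C hC
        exact (main v w hv hw cv cw hs.symm (fun j => (hc j).symm) (by omega) T hT hvT hwT hle
          C hC).symm

end GridCell

/-- A subcomplex of the standard cubulation of `ℝⁿ`: a set of cells that contains all the faces of
its members. -/
structure CubicalSubcomplex (n : ℕ) where
  cells : Set (GridCell n)
  down_closed : ∀ C ∈ cells, ∀ D : GridCell n, D.IsFace C → D ∈ cells

namespace CubicalSubcomplex

variable {n : ℕ}

/-- The underlying subset of `ℝⁿ`. -/
def support (K : CubicalSubcomplex n) : Set (EuclideanSpace ℝ (Fin n)) :=
  ⋃ C ∈ K.cells, C.carrier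

/-- The simplices of the barycentric subdivision, given by their vertices: these are the sets of
centers of the cells in the nonempty finite chains `C₀ ⊂ C₁ ⊂ … ⊂ Cₚ` of cells of `K`. (Coning off
the subdivision of `∂C` from the center of `C` adds the chains with largest member `C`.) -/
def barycentricFaces (K : CubicalSubcomplex n) : Set (Finset (EuclideanSpace ℝ (Fin n))) :=
  {s | ∃ c : Finset (GridCell n), c.Nonempty ∧ (c : Set (GridCell n)) ⊆ K.cells ∧
    IsChain GridCell.IsFace (c : Set (GridCell n)) ∧ s = c.map GridCell.centerEmb}

theorem chain_weights_unique {s t : Finset (GridCell n)}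
    (hs : IsChain GridCell.IsFace (s : Set (GridCell n)))
    (ht : IsChain GridCell.IsFace (t : Set (GridCell n)))
    (w v : GridCell n → ℝ) (hw : ∀ C ∈ s, 0 ≤ w C) (hv : ∀ C ∈ t, 0 ≤ v C)
    (hw0 : ∀ C ∉ s, w C = 0) (hv0 : ∀ C ∉ t, v C = 0)
    (hsum : ∑ C ∈ s, w C = ∑ C ∈ t, v C)
    (hcen : ∑ C ∈ s, w C • C.center = ∑ C ∈ t, v C • C.center) : ∀ C, w C = v C := by
  classical
  have hsS : s ⊆ s ∪ t := Finset.subset_union_left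
  have htS : t ⊆ s ∪ t := Finset.subset_union_right
  have key := GridCell.weights_unique (s ∪ t) _ w v
    (fun C _ => by
      by_cases h : C ∈ s
      · exact hw C h
      · exact (hw0 C h).ge)
    (fun C _ => by
      by_cases h : C ∈ t
      · exact hv C h
      · exact (hv0 C h).ge)
    (hs.mono fun C h => by
      by_contra h'
      exact h.2 (hw0 C h'))
    (ht.mono fun C h => by
      by_contra h'
      exact h.2 (hv0 C h'))
    (by
      rw [← Finset.sum_subset hsS fun C _ h => hw0 C h,
        ← Finset.sum_subset htS fun C _ h => hv0 C h, hsum])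
    (fun j => by
      rw [← Finset.sum_subset hsS fun C _ h => by rw [hw0 C h, zero_mul],
        ← Finset.sum_subset htS fun C _ h => by rw [hv0 C h, zero_mul]]
      have := congrArg (fun x : EuclideanSpace ℝ (Fin n) => x j) hcen
      simpa using this)
    le_rfl
  intro C
  by_cases h : C ∈ s ∪ t
  · exact key C h
  · rw [Finset.mem_union, not_or] at h
    rw [hw0 C h.1, hv0 C h.2]

/-- The barycentric subdivision `β(K)` of a cubical complex, as a geometric simplicial complex. -/
noncomputable def barycentricSubdivision (K : CubicalSubcomplex n) :
    Geometry.SimplicialComplex ℝ (EuclideanSpace ℝ (Fin n)) where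
  faces := K.barycentricFaces
  isRelLowerSet_faces := by
    rintro s ⟨c, hne, hK, hc, rfl⟩
    refine ⟨hne.map, fun t ht htne => ?_⟩
    obtain ⟨d, hd, rfl⟩ := Finset.subset_map_iff.1 ht
    exact ⟨d, Finset.map_nonempty.1 htne, (Finset.coe_subset.2 hd).trans hK,
      hc.mono (Finset.coe_subset.2 hd), rfl⟩
  indep := by
    classical
    rintro s ⟨c, hne, hK, hc, rfl⟩
    suffices H : AffineIndependent ℝ (fun C : c => GridCell.center (C : GridCell n)) by
      have := H.range
      convert! this using 3 <;> simp [GridCell.centerEmb]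
    rw [affineIndependent_iff_of_fintype]
    intro w hw0 hwc C
    rw [Finset.weightedVSub_eq_linear_combination _ hw0] at hwc
    -- compare the positive and the negative parts of the weights
    let z : GridCell n → ℝ := fun D => if h : D ∈ c then w ⟨D, h⟩ else 0
    have zc : ∀ D : c, z D = w D := fun D => by simp [z]
    have z0 : ∀ D ∉ c, z D = 0 := fun D hD => by simp [z, hD]
    have zs : ∑ D ∈ c, z D = 0 := by
      rw [← Finset.sum_coe_sort c, ← hw0]
      exact Finset.sum_congr rfl fun D _ => zc D
    have zv : ∑ D ∈ c, z D • D.center = 0 := by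
      rw [← Finset.sum_coe_sort c, ← hwc]
      exact Finset.sum_congr rfl fun D _ => by rw [zc D]
    have parts : ∀ D, max (z D) 0 - max (-z D) 0 = z D := fun D => by
      rcases le_total (z D) 0 with h | h
      · rw [max_eq_right h, max_eq_left (by linarith)]
        ring
      · rw [max_eq_left h, max_eq_right (by linarith)]
        ring
    have := chain_weights_unique hc hc (fun D => max (z D) 0) (fun D => max (-z D) 0)
      (fun D _ => le_max_right _ _) (fun D _ => le_max_right _ _)
      (fun D hD => by simp [z0 D hD]) (fun D hD => by simp [z0 D hD])
      (by
        rw [← sub_eq_zero, ← Finset.sum_sub_distrib]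
        exact (Finset.sum_congr rfl fun D _ => parts D).trans zs)
      (by
        rw [← sub_eq_zero, ← Finset.sum_sub_distrib]
        exact (Finset.sum_congr rfl fun D _ => by rw [← sub_smul, parts D]).trans zv) C
    rw [← zc C, ← parts C]
    exact sub_eq_zero.2 this
  inter_subset_convexHull := by
    classical
    rintro s t ⟨c, -, -, hc, rfl⟩ ⟨d, -, -, hd, rfl⟩ x ⟨hx, hy⟩
    have coords : ∀ e : Finset (GridCell n),
        x ∈ convexHull ℝ ((e.map GridCell.centerEmb : Finset _) : Set (EuclideanSpace ℝ (Fin n))) →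
        ∃ w : GridCell n → ℝ, (∀ C ∈ e, 0 ≤ w C) ∧ (∀ C ∉ e, w C = 0) ∧ ∑ C ∈ e, w C = 1 ∧
          ∑ C ∈ e, w C • C.center = x := by
      intro e he
      obtain ⟨w, h0, h1, h2⟩ := Finset.mem_convexHull'.1 he
      refine ⟨fun C => if C ∈ e then w C.center else 0, fun C hC => ?_, fun C hC => if_neg hC,
        ?_, ?_⟩
      · simp only [if_pos hC]
        exact h0 _ (Finset.mem_map_of_mem GridCell.centerEmb hC)
      · rw [Finset.sum_map] at h1
        rw [← h1]
        exact Finset.sum_congr rfl fun C hC => if_pos hC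
      · rw [Finset.sum_map] at h2
        rw [← h2]
        refine Finset.sum_congr rfl fun C hC => ?_
        simp only [if_pos hC]
        rfl
    obtain ⟨w, w0, w1, ws, wx⟩ := coords c hx
    obtain ⟨v, v0, v1, vs, vx⟩ := coords d hy
    have hwv := chain_weights_unique hc hd w v w0 v0 w1 v1 (ws.trans vs.symm) (wx.trans vx.symm)
    have hsub : c ∩ d ⊆ c := Finset.inter_subset_left
    have hz : ∀ C ∈ c, C ∉ c ∩ d → w C = 0 := fun C hC hC' => by
      rw [hwv C]
      exact v1 C fun h => hC' (Finset.mem_inter.2 ⟨hC, h⟩)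
    rw [← wx, ← Finset.sum_subset hsub fun C hC hC' => by rw [hz C hC hC', zero_smul]]
    refine (convex_convexHull ℝ _).sum_mem (fun C hC => w0 C (hsub hC)) ?_ fun C hC => ?_
    · rw [Finset.sum_subset hsub hz, ws]
    · exact subset_convexHull ℝ _ ⟨Finset.mem_map_of_mem GridCell.centerEmb (hsub hC),
        Finset.mem_map_of_mem GridCell.centerEmb (Finset.mem_inter.1 hC).2⟩

end CubicalSubcomplex

/-! ### Simplicial isomorphisms onto a geometric simplicial complex -/

/-- The standard geometric realization of an abstract simplicial complex with finitely many
vertices, through barycentric coordinates. -/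
def realization {ι : Type*} [Fintype ι] (N : PreAbstractSimplicialComplex ι) : Set (ι → ℝ) :=
  {w | w ∈ stdSimplex ℝ ι ∧ ∃ s ∈ N.faces, ∀ i, i ∈ s ↔ w i ≠ 0}

/-- The map that sends the vertex `i` to `c i` and is linear on simplices, in barycentric
coordinates. -/
def linearExtension {ι E : Type*} [Fintype ι] [AddCommGroup E] [Module ℝ E] (c : ι → E)
    (w : ι → ℝ) : E :=
  ∑ i, w i • c i

/-- The linear extension of `c`, defined on the realization of the abstract complex `N`, is a
simplicial isomorphism onto the geometric simplicial complex `L`: it is bijective on vertices, the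
vertex sets of simplices correspond to each other, and it is a bijection between the underlying
spaces. -/
structure IsSimplicialIsoOnto {ι E : Type*} [Fintype ι] [AddCommGroup E] [Module ℝ E]
    (N : PreAbstractSimplicialComplex ι) (c : ι → E) (L : Geometry.SimplicialComplex ℝ E) :
    Prop where
  vertices : BijOn c {i | {i} ∈ N.faces} L.vertices
  faces : ∀ s : Finset ι, s ∈ N.faces ↔ ∃ t ∈ L.faces, (t : Set E) = c '' s
  realization : BijOn (linearExtension c) (realization N) L.space

/-! ### Moebius geometry of the 4-sphere -/

/-- Euclidean 4-space. -/
abbrev E4 := EuclideanSpace ℝ (Fin 4)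

/-- The 4-sphere as the one-point compactification of Euclidean 4-space. -/
abbrev S4 := OnePoint E4

/-- The inversion of the 4-sphere in the round sphere with center `c` and radius `r`, as a map; it
interchanges `c` and `∞`. -/
noncomputable def inversionFun (c : E4) (r : ℝ) (p : S4) : S4 :=
  open Classical in
  p.elim (c : S4) fun x => if x = c then OnePoint.infty else
    (EuclideanGeometry.inversion c r x : E4)

theorem inversionFun_infty (c : E4) (r : ℝ) : inversionFun c r OnePoint.infty = c := rfl

theorem inversionFun_center (c : E4) (r : ℝ) : inversionFun c r (c : S4) = OnePoint.infty := by
  simp [inversionFun]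

theorem inversionFun_coe (c : E4) (r : ℝ) {x : E4} (hx : x ≠ c) :
    inversionFun c r (x : S4) = (EuclideanGeometry.inversion c r x : E4) := by
  simp [inversionFun, hx]

theorem inversionFun_involutive (c : E4) {r : ℝ} (hr : r ≠ 0) :
    Function.Involutive (inversionFun c r) := by
  intro p
  induction p using OnePoint.rec with
  | infty => rw [inversionFun_infty, inversionFun_center]
  | coe x =>
    by_cases hx : x = c
    · rw [hx, inversionFun_center, inversionFun_infty]
    · rw [inversionFun_coe c r hx, inversionFun_coe c r
        (fun h => hx ((EuclideanGeometry.inversion_eq_center hr).1 h)),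
        EuclideanGeometry.inversion_inversion c hr]

theorem continuous_inversionFun (c : E4) {r : ℝ} (hr : r ≠ 0) : Continuous (inversionFun c r) := by
  rw [OnePoint.continuous_iff]
  constructor
  · rw [inversionFun_infty, coclosedCompact_eq_cocompact, ← Metric.cobounded_eq_cocompact]
    have h1 : Tendsto (fun x : E4 => EuclideanGeometry.inversion c r x)
        (Bornology.cobounded E4) (𝓝 c) := by
      rw [tendsto_iff_dist_tendsto_zero]
      simp only [EuclideanGeometry.dist_inversion_center]
      exact (Metric.tendsto_dist_right_cobounded_atTop c).const_div_atTop _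
    have h2 : Tendsto (fun x : E4 => ((EuclideanGeometry.inversion c r x : E4) : S4))
        (Bornology.cobounded E4) (𝓝 (c : S4)) :=
      (OnePoint.continuous_coe.tendsto c).comp h1
    refine h2.congr' ?_
    have h3 : ∀ᶠ x : E4 in Bornology.cobounded E4, x ≠ c :=
      Bornology.eventually_ne_cobounded c
    filter_upwards [h3] with x hx
    exact (inversionFun_coe c r hx).symm
  · rw [continuous_iff_continuousAt]
    intro x
    by_cases hx : x = c
    · subst hx
      rw [← continuousWithinAt_compl_self, ContinuousWithinAt, inversionFun_center]
      have h1 := EuclideanGeometry.tendsto_inversion_nhdsNE_center_cobounded (c := x) hr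
      rw [Metric.cobounded_eq_cocompact, ← coclosedCompact_eq_cocompact] at h1
      refine (OnePoint.tendsto_coe_infty.comp h1).congr' ?_
      filter_upwards [self_mem_nhdsWithin] with y hy
      exact (inversionFun_coe x r hy).symm
    · have h1 : ContinuousAt (fun y : E4 => ((EuclideanGeometry.inversion c r y : E4) : S4)) x :=
        OnePoint.continuous_coe.continuousAt.comp
          (continuousAt_const.inversion continuousAt_const continuousAt_id hx)
      refine h1.congr ?_
      filter_upwards [isOpen_ne.mem_nhds hx] with y hy
      exact (inversionFun_coe c r hy).symm

/-- A round open ball in Euclidean 4-space, with its center and its (positive) radius. -/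
structure RoundBall where
  center : E4
  radius : ℝ
  radius_pos : 0 < radius

namespace RoundBall

/-- The open ball as a subset of `ℝ⁴`. -/
def ball (B : RoundBall) : Set E4 := Metric.ball B.center B.radius

/-- The Moebius inversion in the boundary sphere of a round ball. -/
noncomputable def inversion (B : RoundBall) : S4 ≃ₜ S4 where
  toEquiv := (inversionFun_involutive B.center B.radius_pos.ne').toPerm
  continuous_toFun := continuous_inversionFun B.center B.radius_pos.ne'
  continuous_invFun := continuous_inversionFun B.center B.radius_pos.ne'

end RoundBall

/-- The full Moebius group of the 4-sphere, generated by the inversions in round spheres. (The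
reflections in hyperplanes, i.e. the inversions in the round spheres through `∞`, are conjugates of
these inversions by one another.) -/
noncomputable def Mob : Subgroup (S4 ≃ₜ S4) := Subgroup.closure (range RoundBall.inversion)

/-- The homeomorphism group of the 4-sphere carries the topology of uniform convergence, i.e. the
compact-open topology; the Moebius group carries the induced topology. -/
instance : TopologicalSpace (S4 ≃ₜ S4) :=
  TopologicalSpace.induced (fun g => (g : C(S4, S4))) inferInstance

/-- A discrete reflection group: a discrete subgroup of the Moebius group that is generated by
inversions in round spheres. -/
structure IsDiscreteReflectionGroup (G : Subgroup (S4 ≃ₜ S4)) : Prop where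
  le_mob : G ≤ Mob
  generated : ∃ T ⊆ range RoundBall.inversion, G = Subgroup.closure T
  discrete : DiscreteTopology G

/-- The domain of discontinuity: the points that have a neighborhood `U` such that `g U` meets `U`
for finitely many group elements `g` only. -/
def domainOfDiscontinuity (G : Subgroup (S4 ≃ₜ S4)) : Set S4 :=
  {p | ∃ U ∈ 𝓝 p, {g | g ∈ G ∧ (g '' U ∩ U).Nonempty}.Finite}

/-- `Φ` is a (closed, locally finite) fundamental domain of the Moebius group `G`: it is the closure
of its interior, the translates of the interior by distinct group elements are disjoint, and the
translates of `Φ` cover the domain of discontinuity and are locally finite there. -/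
structure IsKleinianFundamentalDomain (G : Subgroup (S4 ≃ₜ S4)) (Φ : Set S4) : Prop where
  closure_interior : closure (interior Φ) = Φ
  disjoint : ∀ g ∈ G, g ≠ 1 → Disjoint (g '' interior Φ) (interior Φ)
  covers : domainOfDiscontinuity G ⊆ ⋃ g ∈ G, g '' Φ
  locally_finite : ∀ p ∈ domainOfDiscontinuity G,
    ∃ U ∈ 𝓝 p, {g | g ∈ G ∧ (g '' Φ ∩ U).Nonempty}.Finite

/-- The nerve of a family of round balls: the nonempty finite sets of indices for which the balls
have a common point. -/
def nerve {ι : Type*} (B : ι → RoundBall) : PreAbstractSimplicialComplex ι where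
  faces := {s | s.Nonempty ∧ (⋂ i ∈ s, (B i).ball).Nonempty}
  isRelLowerSet_faces := by
    rintro s ⟨hs, hne⟩
    exact ⟨hs, fun t hts ht => ⟨ht, hne.mono (biInter_subset_biInter_left hts)⟩⟩

/-!
The balls around the centers of the vertices, edges and squares of `K` get three radii `a`, `b`, `c`
such that the spheres of an incident vertex and edge meet at the angle `π/2`, those of an edge and a
square at `π/3`, and those of a vertex and a square at `π/4` (`exists_radii`). Since
`1/2 + 1/3 + 1/4 > 1`, the three balls of a flag have a common point. The squared distance of the
centers of two cells is a quarter of an integer that is at least the difference of the dimensions,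
has the same parity, and equals the difference only for incident cells
(`GridCell.le_four_mul_dist_center_sq`); for these radii, hence, the closed balls of different
cells that are not incident are disjoint. So the simplices of the nerve are the chains of cells.

Represent points of the sphere by rays of the light cone in the Lorentzian space of signature
`(5, 1)` and spheres by their unit spacelike normals. The inversions become the reflections in the
normals `e i`, and the angles turn the normals into a Coxeter system. By the theorem of Tits
(`IsCoxeterSystemOfNormals.wordMap_mem_positiveCone`), a product of reflections spelled by a reduced
word maps a simple normal into the cone spanned by all of them, unless a reflection shortens the
word. This has three consequences. A nontrivial element moves the interior of the exterior domain
into one of the balls; as `∞` is an interior point, the group is discrete. A point of the domain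
minimizes, in its orbit, the last coordinate of its null vector, which is the reciprocal of the
conformal factor of the element (`IsCoxeterSystemOfNormals.height_wordMap_le_one`). And this
coordinate is bounded below on the nontrivial translates of the null vector of `∞`, so that the
orbit points `g⁻¹ ∞` of elements with large isometric spheres are separated from each other and
there are finitely many of them (`IsCoxeterSystemOfNormals.finite_height_le`).

Near a point `x` of the domain of discontinuity, therefore, only finitely many elements do not
contract. An element of least height, that is, of greatest conformal factor at `x`, moves `x` into
the exterior domain, since otherwise one more inversion would expand further. So the translates of
the domain cover the domain of discontinuity, and they are locally finite.
-/

/-! ### Groups generated by reflections with Coxeter angles -/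

section Reflections

variable {V : Type*} [AddCommGroup V] [Module ℝ V]

/-- The reflection `v ↦ v - 2 B(v, a) a` in the vector `a`, meant for `B(a, a) = 1`. -/
noncomputable def formReflection (B : LinearMap.BilinForm ℝ V) (a : V) : Module.End ℝ V :=
  LinearMap.id - (2 : ℝ) • (B.flip a).smulRight a

theorem formReflection_apply (B : LinearMap.BilinForm ℝ V) (a v : V) :
    formReflection B a v = v - (2 * B v a) • a := by
  simp [formReflection, mul_smul]

/-- A system of unit vectors any two of which enclose the angle `π - π/m` for an integer `m ≥ 2`,
or span a subspace on which the form is not positive definite (the mirrors are parallel or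
ultraparallel). Such vectors are the outward normals of a Coxeter polyhedron. -/
structure IsCoxeterSystemOfNormals {ι : Type*} (B : LinearMap.BilinForm ℝ V) (e : ι → V) :
    Prop where
  symm : ∀ u v, B u v = B v u
  unit : ∀ i, B (e i) (e i) = 1
  angle : ∀ i j, i ≠ j →
    B (e i) (e j) ≤ -1 ∨ ∃ m : ℕ, 2 ≤ m ∧ B (e i) (e j) = -Real.cos (Real.pi / m)

/-- The product of the reflections spelled by a word in the index set. -/
noncomputable def wordMap {ι : Type*} (B : LinearMap.BilinForm ℝ V) (e : ι → V) (l : List ι) :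
    Module.End ℝ V :=
  (l.map fun i => formReflection B (e i)).prod

/-- The cone of nonnegative linear combinations of the vectors `e i`. -/
noncomputable def positiveCone {ι : Type*} (e : ι → V) : PointedCone ℝ V :=
  PointedCone.hull ℝ (range e)

/-- The `k`-th letter from the right, starting with `0`, in an alternating word ending in `t`. -/
def altLetter {ι : Type*} (s t : ι) (k : ℕ) : ι := if Even k then t else s

/-- The alternating word `… s t s t` with `k` letters and last letter `t`. -/
def altWord {ι : Type*} (s t : ι) : ℕ → List ι
  | 0 => []
  | k + 1 => altLetter s t k :: altWord s t k

section

variable {ι : Type*} {B : LinearMap.BilinForm ℝ V} {e : ι → V}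

@[simp] theorem wordMap_nil : wordMap B e [] = 1 := rfl

@[simp] theorem wordMap_cons (i : ι) (l : List ι) :
    wordMap B e (i :: l) = formReflection B (e i) * wordMap B e l := by
  simp [wordMap]

@[simp] theorem wordMap_append (l l' : List ι) :
    wordMap B e (l ++ l') = wordMap B e l * wordMap B e l' := by
  simp [wordMap]

theorem mem_positiveCone (i : ι) : e i ∈ positiveCone e :=
  Submodule.subset_span ⟨i, rfl⟩

theorem smul_mem_positiveCone {c : ℝ} (hc : 0 ≤ c) {v : V} (hv : v ∈ positiveCone e) :
    c • v ∈ positiveCone e :=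
  (positiveCone e).smul_mem hc hv

theorem nonneg_of_mem_positiveCone (φ : V →ₗ[ℝ] ℝ) (hφ : ∀ i, 0 ≤ φ (e i)) {v : V}
    (hv : v ∈ positiveCone e) : 0 ≤ φ v := by
  induction hv using Submodule.span_induction with
  | mem x h => obtain ⟨i, rfl⟩ := h; exact hφ i
  | zero => simp
  | add x y _ _ h1 h2 => rw [map_add]; exact add_nonneg h1 h2
  | smul a x _ h =>
    have : φ (a • x) = (a : ℝ) * φ x := φ.map_smul (a : ℝ) x
    rw [this]
    exact mul_nonneg a.2 h

theorem neg_of_mem_positiveCone (φ : V →ₗ[ℝ] ℝ) (hφ : ∀ i, φ (e i) < 0) {v : V}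
    (hv : v ∈ positiveCone e) (h0 : v ≠ 0) : φ v < 0 := by
  suffices H : v = 0 ∨ φ v < 0 from H.resolve_left h0
  clear h0
  induction hv using Submodule.span_induction with
  | mem x h => obtain ⟨i, rfl⟩ := h; exact Or.inr (hφ i)
  | zero => exact Or.inl rfl
  | add x y _ _ h1 h2 =>
    rcases h1 with rfl | h1
    · simpa using h2
    · rcases h2 with rfl | h2
      · exact Or.inr (by simpa using h1)
      · exact Or.inr (by rw [map_add]; linarith)
  | smul a x _ h =>
    have e1 : φ (a • x) = (a : ℝ) * φ x := φ.map_smul (a : ℝ) x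
    rcases h with rfl | h
    · exact Or.inl (smul_zero _)
    · rcases a.2.eq_or_lt with ha | ha
      · left
        have : (a : ℝ) • x = 0 := by rw [← ha, zero_smul]
        exact this
      · right
        rw [e1]
        exact mul_neg_of_pos_of_neg ha h

theorem altLetter_add_two (s t : ι) (k : ℕ) : altLetter s t (k + 2) = altLetter s t k := by
  simp [altLetter, Nat.even_add]

theorem length_altWord (s t : ι) (k : ℕ) : (altWord s t k).length = k := by
  induction k with
  | zero => rfl
  | succ k ih => simp [altWord, ih]

/-- An alternating word is a suffix of every longer one with the same last letters. -/
theorem altWord_eq_append (s t : ι) {k n : ℕ} (h : n ≤ k) :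
    ∃ l : List ι, l.length = k - n ∧ altWord s t k = l ++ altWord s t n := by
  induction k, h using Nat.le_induction with
  | base => exact ⟨[], by simp, rfl⟩
  | succ k hk ih =>
    obtain ⟨l, h1, h2⟩ := ih
    exact ⟨altLetter s t k :: l, by simp [h1]; omega, by simp [altWord, h2]⟩

namespace IsCoxeterSystemOfNormals

theorem formReflection_self (h : IsCoxeterSystemOfNormals B e)
    (i : ι) : formReflection B (e i) (e i) = -e i := by
  rw [formReflection_apply, h.unit]
  module

theorem formReflection_mul_self (h : IsCoxeterSystemOfNormals B e) (i : ι) :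
    formReflection B (e i) * formReflection B (e i) = 1 := by
  ext v
  simp only [Module.End.mul_apply, formReflection_apply, map_sub, map_smul, h.unit,
    Module.End.one_apply]
  module

theorem form_formReflection (h : IsCoxeterSystemOfNormals B e) (i : ι) (u v : V) :
    B (formReflection B (e i) u) v = B u (formReflection B (e i) v) := by
  simp only [formReflection_apply, map_sub, map_smul, LinearMap.sub_apply, LinearMap.smul_apply,
    smul_eq_mul]
  rw [h.symm (e i) v]
  ring

theorem wordMap_mul_reverse (h : IsCoxeterSystemOfNormals B e)
    (l : List ι) : wordMap B e l * wordMap B e l.reverse = 1 := by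
  induction l with
  | nil => simp
  | cons i l ih =>
    rw [List.reverse_cons, wordMap_append, wordMap_cons, wordMap_cons, wordMap_nil, mul_one,
      mul_assoc, ← mul_assoc (wordMap B e l), ih, one_mul, h.formReflection_mul_self]

theorem wordMap_reverse_mul (h : IsCoxeterSystemOfNormals B e)
    (l : List ι) : wordMap B e l.reverse * wordMap B e l = 1 := by
  simpa using h.wordMap_mul_reverse l.reverse

theorem form_wordMap (h : IsCoxeterSystemOfNormals B e) (l : List ι) (u v : V) :
    B (wordMap B e l u) v = B u (wordMap B e l.reverse v) := by
  induction l generalizing u v with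
  | nil => simp
  | cons i l ih =>
    simp [h.form_formReflection, ih]

theorem wordMap_injective (h : IsCoxeterSystemOfNormals B e)
    (l : List ι) : Function.Injective (wordMap B e l) := by
  intro u v huv
  have := congrArg (wordMap B e l.reverse) huv
  simpa only [← Module.End.mul_apply, h.wordMap_reverse_mul, Module.End.one_apply] using this

theorem ne_zero (h : IsCoxeterSystemOfNormals B e) (i : ι) : e i ≠ 0 := by
  intro h0
  have := h.unit i
  simp [h0] at this

/-- The reflection in the image of a normal is the conjugate reflection. -/
theorem formReflection_mul_wordMap (h : IsCoxeterSystemOfNormals B e)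
    (l : List ι) (i j : ι) (hij : wordMap B e l (e i) = e j) :
    formReflection B (e j) * wordMap B e l = wordMap B e l * formReflection B (e i) := by
  ext v
  simp only [Module.End.mul_apply, formReflection_apply, map_sub, map_smul, hij]
  have : B (wordMap B e l v) (e j) = B v (e i) := by
    rw [← hij, h.form_wordMap, ← Module.End.mul_apply, h.wordMap_reverse_mul]
    rfl
  rw [this]

/-- The images of `e s` under alternating products of the reflections `s` and `t` have coefficients
given by a Chebyshev recursion. -/
theorem wordMap_altWord (h : IsCoxeterSystemOfNormals B e)
    (s t : ι) (A : ℕ → ℝ) (h0 : A 0 = 0) (h1 : A 1 = 1)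
    (hA : ∀ k, A (k + 2) = -2 * B (e s) (e t) * A (k + 1) - A k) (k : ℕ) :
    wordMap B e (altWord s t k) (e s) =
      A k • e (altLetter s t k) + A (k + 1) • e (altLetter s t (k + 1)) := by
  induction k with
  | zero => simp [altWord, altLetter, h0, h1]
  | succ k ih =>
    have hB : B (e (altLetter s t (k + 1))) (e (altLetter s t k)) = B (e s) (e t) := by
      by_cases hk : Even k
      · simp [altLetter, Nat.even_add_one, hk]
      · simp [altLetter, Nat.even_add_one, hk, h.symm (e t) (e s)]
    rw [altWord, wordMap_cons, Module.End.mul_apply, ih, altLetter_add_two, hA, map_add, map_smul,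
      map_smul, h.formReflection_self, formReflection_apply, hB]
    module

/-- In the subgroup generated by two reflections, the alternating images of a normal are positive
until a braid relation holds. -/
theorem altWord_dichotomy (h : IsCoxeterSystemOfNormals B e) (s t : ι) (hst : s ≠ t) :
    (∀ k, ∃ a b : ℝ, 0 ≤ a ∧ 0 ≤ b ∧ wordMap B e (altWord s t k) (e s) =
      a • e (altLetter s t k) + b • e (altLetter s t (k + 1))) ∨
    ∃ n, (∀ k ≤ n, ∃ a b : ℝ, 0 ≤ a ∧ 0 ≤ b ∧ wordMap B e (altWord s t k) (e s) =
      a • e (altLetter s t k) + b • e (altLetter s t (k + 1))) ∧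
      wordMap B e (altWord s t (n + 1)) * formReflection B (e s) =
        wordMap B e (altWord s t n) := by
  rcases h.angle s t hst with hc | ⟨m, hm, hc⟩
  · left
    -- the coefficients increase, by convexity of the recursion
    let A2 : ℕ → ℝ × ℝ := fun k => Nat.rec (0, 1)
      (fun _ p => (p.2, -2 * B (e s) (e t) * p.2 - p.1)) k
    let A : ℕ → ℝ := fun k => (A2 k).1
    have hs : ∀ k, A (k + 1) = (A2 k).2 := fun k => rfl
    have hA : ∀ k, A (k + 2) = -2 * B (e s) (e t) * A (k + 1) - A k := fun k => rfl
    have hpos : ∀ k, 0 ≤ A k ∧ A k ≤ A (k + 1) := by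
      intro k
      induction k with
      | zero => exact ⟨le_rfl, zero_le_one⟩
      | succ k ih =>
        refine ⟨ih.1.trans ih.2, ?_⟩
        rw [hA]
        nlinarith [ih.1, ih.2]
    intro k
    exact ⟨A k, A (k + 1), (hpos k).1, (hpos (k + 1)).1,
      h.wordMap_altWord s t A rfl rfl hA k⟩
  · right
    obtain ⟨n, rfl⟩ : ∃ n, m = n + 1 := ⟨m - 1, by omega⟩
    set θ : ℝ := Real.pi / ((n + 1 : ℕ) : ℝ) with hθ
    have hm0 : (0 : ℝ) < ((n + 1 : ℕ) : ℝ) := by positivity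
    have hm2 : (2 : ℝ) ≤ ((n + 1 : ℕ) : ℝ) := by exact_mod_cast hm
    have hmθ : ((n + 1 : ℕ) : ℝ) * θ = Real.pi := by rw [hθ]; field_simp
    have hθ0 : 0 < θ := div_pos Real.pi_pos hm0
    have hsin : 0 < Real.sin θ :=
      Real.sin_pos_of_pos_of_lt_pi hθ0 (by nlinarith)
    let A : ℕ → ℝ := fun k => Real.sin (k * θ) / Real.sin θ
    have hA0 : A 0 = 0 := by simp [A]
    have hA1 : A 1 = 1 := by simp [A, hsin.ne']
    have hA : ∀ k, A (k + 2) = -2 * B (e s) (e t) * A (k + 1) - A k := by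
      intro k
      have e2 : ((k + 2 : ℕ) : ℝ) * θ = ((k + 1 : ℕ) : ℝ) * θ + θ := by push_cast; ring
      have e0 : (k : ℝ) * θ = ((k + 1 : ℕ) : ℝ) * θ - θ := by push_cast; ring
      simp only [A]
      rw [hc, e2, e0, Real.sin_add, Real.sin_sub]
      field_simp
      ring
    have hpos : ∀ k ≤ n + 1, 0 ≤ A k := by
      intro k hk
      refine div_nonneg (Real.sin_nonneg_of_nonneg_of_le_pi (by positivity) ?_) hsin.le
      rw [← hmθ]
      exact mul_le_mul_of_nonneg_right (by exact_mod_cast hk) hθ0.le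
    have hAn1 : A (n + 1) = 0 := by
      simp only [A]
      rw [hmθ, Real.sin_pi, zero_div]
    have hAn : A n = 1 := by
      have e0 : (n : ℝ) * θ = Real.pi - θ := by rw [← hmθ]; push_cast; ring
      simp only [A]
      rw [e0, Real.sin_pi_sub, div_self hsin.ne']
    refine ⟨n, fun k hk => ⟨A k, A (k + 1), hpos k (by omega), hpos (k + 1) (by omega),
      h.wordMap_altWord s t A hA0 hA1 hA k⟩, ?_⟩
    -- the last of these images is a normal again, which is a braid relation
    have hn := h.wordMap_altWord s t A hA0 hA1 hA n
    rw [hAn, hAn1, one_smul, zero_smul, add_zero] at hn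
    rw [altWord, wordMap_cons, h.formReflection_mul_wordMap _ _ _ hn, mul_assoc,
      h.formReflection_mul_self, mul_one]

/-- The theorem of Tits: if the word `l` is reduced and multiplication by the reflection `i` on the
right does not make it shorter, then `l` maps the normal `e i` into the cone spanned by all
normals. -/
theorem wordMap_mem_positiveCone (h : IsCoxeterSystemOfNormals B e)
    (N : ℕ) : ∀ (l : List ι) (i : ι), l.length = N →
    (∀ l', wordMap B e l' = wordMap B e l → l.length ≤ l'.length) →
    (∀ l', wordMap B e l' = wordMap B e l * formReflection B (e i) → l.length ≤ l'.length) →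
    wordMap B e l (e i) ∈ positiveCone e := by
  induction N using Nat.strong_induction_on with
  | _ N ih =>
    intro l s hl hred hs
    rcases List.eq_nil_or_concat l with rfl | ⟨l₀, t, rfl⟩
    · exact mem_positiveCone s
    rw [List.concat_eq_append] at *
    have hst : s ≠ t := by
      rintro rfl
      have := hs l₀ (by rw [wordMap_append, wordMap_cons, wordMap_nil, mul_one, mul_assoc,
        h.formReflection_mul_self, mul_one])
      simp at this
    set w := wordMap B e (l₀ ++ [t]) with hw
    -- split off the longest possible alternating right factor
    let Q : ℕ → Prop := fun k => ∃ v : List ι,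
      wordMap B e v * wordMap B e (altWord s t k) = w ∧ v.length + k = N
    classical
    have hQ1 : Q 1 := ⟨l₀, by simp [hw, altWord, altLetter], by simpa using hl⟩
    have hQN : ∀ k, Q k → k ≤ N := by
      rintro k ⟨v, -, hv⟩
      omega
    have hN1 := hQN 1 hQ1
    set k := Nat.findGreatest Q N with hk
    obtain ⟨v, hv, hvN⟩ : Q k := Nat.findGreatest_spec hN1 hQ1
    have hk1 : 1 ≤ k := Nat.le_findGreatest hN1 hQ1
    have hkmax : ∀ k', Q k' → k' ≤ k := fun k' hk' => Nat.le_findGreatest (hQN k' hk') hk'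
    have hlow : ∀ l', wordMap B e l' = w → N ≤ l'.length := fun l' hl' => hl ▸ hred l' hl'
    have hlow' : ∀ l', wordMap B e l' = w * formReflection B (e s) → N ≤ l'.length :=
      fun l' hl' => hl ▸ hs l' hl'
    have hvred : ∀ v', wordMap B e v' = wordMap B e v → v.length ≤ v'.length := by
      intro v' hv'
      have := hlow (v' ++ altWord s t k) (by rw [wordMap_append, hv', hv])
      rw [List.length_append, length_altWord] at this
      omega
    -- both normals are mapped into the cone by the left factor
    have hx : wordMap B e v (e (altLetter s t k)) ∈ positiveCone e := by
      refine ih v.length (by omega) v _ rfl hvred fun v' hv' => ?_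
      by_contra! hlt
      have e1 : wordMap B e v' * wordMap B e (altWord s t (k + 1)) = w := by
        rw [hv', altWord, wordMap_cons, mul_assoc, ← mul_assoc (formReflection B _),
          h.formReflection_mul_self, one_mul, hv]
      have e2 := hlow (v' ++ altWord s t (k + 1)) (by rw [wordMap_append, e1])
      rw [List.length_append, length_altWord] at e2
      have := hkmax (k + 1) ⟨v', e1, by omega⟩
      omega
    have hy : wordMap B e v (e (altLetter s t (k + 1))) ∈ positiveCone e := by
      obtain ⟨j, hj⟩ : ∃ j, k = j + 1 := ⟨k - 1, by omega⟩
      rw [hj] at hv hvN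
      rw [hj, altLetter_add_two]
      refine ih v.length (by omega) v _ rfl hvred fun v' hv' => ?_
      by_contra! hlt
      have e1 : wordMap B e v' * wordMap B e (altWord s t j) = w := by
        rw [hv', ← hv, altWord, wordMap_cons, mul_assoc]
      have e2 := hlow (v' ++ altWord s t j) (by rw [wordMap_append, e1])
      rw [List.length_append, length_altWord] at e2
      omega
    have fin : ∀ a b : ℝ, 0 ≤ a → 0 ≤ b → wordMap B e (altWord s t k) (e s) =
        a • e (altLetter s t k) + b • e (altLetter s t (k + 1)) → w (e s) ∈ positiveCone e := by
      intro a b ha hb hab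
      rw [← hv, Module.End.mul_apply, hab, map_add, map_smul, map_smul]
      exact add_mem (smul_mem_positiveCone ha hx) (smul_mem_positiveCone hb hy)
    rcases h.altWord_dichotomy s t hst with hall | ⟨n, hn, hbraid⟩
    · obtain ⟨a, b, ha, hb, hab⟩ := hall k
      exact fin a b ha hb hab
    · rcases le_or_gt k n with hkn | hkn
      · obtain ⟨a, b, ha, hb, hab⟩ := hn k hkn
        exact fin a b ha hb hab
      · exfalso
        obtain ⟨u, hu, huk⟩ := altWord_eq_append s t (show n + 1 ≤ k from hkn)
        have e1 := hlow' (v ++ (u ++ altWord s t n)) (by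
          rw [← hv, huk, wordMap_append, wordMap_append, wordMap_append, ← hbraid]
          simp only [mul_assoc])
        rw [List.length_append, List.length_append, length_altWord] at e1
        omega

theorem exists_reduced (l : List ι) : ∃ l₀ : List ι, wordMap B e l₀ = wordMap B e l ∧
    ∀ l', wordMap B e l' = wordMap B e l₀ → l₀.length ≤ l'.length := by
  classical
  have hex : ∃ n, ∃ l₀ : List ι, wordMap B e l₀ = wordMap B e l ∧ l₀.length = n :=
    ⟨_, l, rfl, rfl⟩
  obtain ⟨l₀, h1, h2⟩ := Nat.find_spec hex
  exact ⟨l₀, h1, fun l' hl' => h2 ▸ Nat.find_min' hex ⟨l', hl'.trans h1, rfl⟩⟩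

/-- A nontrivial product of reflections is `u s` with a shorter reduced word `u` that maps the
normal of `s` into the positive cone. -/
theorem exists_eq_mul_formReflection (h : IsCoxeterSystemOfNormals B e)
    (l : List ι) (hl : wordMap B e l ≠ 1) :
    ∃ (u : List ι) (i : ι), wordMap B e l = wordMap B e u * formReflection B (e i) ∧
      wordMap B e u (e i) ∈ positiveCone e ∧
      ∀ l', wordMap B e l' = wordMap B e l → u.length < l'.length := by
  obtain ⟨l₀, h1, h2⟩ := exists_reduced (B := B) (e := e) l
  rcases List.eq_nil_or_concat l₀ with rfl | ⟨u, i, rfl⟩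
  · exact absurd h1.symm hl
  rw [List.concat_eq_append] at *
  have hui : wordMap B e (u ++ [i]) = wordMap B e u * formReflection B (e i) := by simp
  refine ⟨u, i, by rw [← h1, hui],
    h.wordMap_mem_positiveCone _ u i rfl (fun l' hl' => ?_) (fun l' hl' => ?_), fun l' hl' => ?_⟩
  · have := h2 (l' ++ [i]) (by rw [wordMap_append, hl', ← wordMap_append])
    simpa using this
  · have := h2 l' (hl'.trans hui.symm)
    simp only [List.length_append, List.length_cons, List.length_nil] at this
    omega
  · have := h2 l' (hl'.trans h1.symm)
    simp only [List.length_append, List.length_cons, List.length_nil] at this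
    omega

/-- A nontrivial product of reflections maps the open chamber beyond one of its walls. -/
theorem exists_form_wordMap_pos (h : IsCoxeterSystemOfNormals B e)
    (l : List ι) (hl : wordMap B e l ≠ 1) :
    ∃ i, ∀ v, (∀ j, B v (e j) < 0) → 0 < B (wordMap B e l v) (e i) := by
  have hl' : wordMap B e l.reverse ≠ 1 := by
    intro h1
    apply hl
    have := h.wordMap_mul_reverse l
    rwa [h1, mul_one] at this
  obtain ⟨u, i, h1, h2, -⟩ := h.exists_eq_mul_formReflection _ hl'
  refine ⟨i, fun v hv => ?_⟩
  rw [h.form_wordMap, h1, Module.End.mul_apply, h.formReflection_self, map_neg, map_neg]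
  refine neg_pos.2 (neg_of_mem_positiveCone (B v) hv h2 fun h0 => h.ne_zero i ?_)
  exact h.wordMap_injective u (by rw [h0, map_zero])

/-- Products of reflections move a point of the closed chamber in the direction of the positive
cone. -/
theorem wordMap_sub_mem_positiveCone (h : IsCoxeterSystemOfNormals B e)
    (l : List ι) {v : V} (hv : ∀ i, B v (e i) ≤ 0) :
    wordMap B e l v - v ∈ positiveCone e := by
  obtain ⟨n, hn⟩ : ∃ n, l.length ≤ n := ⟨_, le_rfl⟩
  induction n using Nat.strong_induction_on generalizing l with
  | _ n ih =>
    by_cases hl : wordMap B e l = 1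
    · simp [hl]
    obtain ⟨u, i, h1, h2, h3⟩ := h.exists_eq_mul_formReflection l hl
    have h4 := ih u.length (by have := h3 l rfl; omega) u le_rfl
    have : wordMap B e l v - v =
        (wordMap B e u v - v) + (-2 * B v (e i)) • wordMap B e u (e i) := by
      rw [h1, Module.End.mul_apply, formReflection_apply, map_sub, map_smul]
      module
    rw [this]
    exact add_mem h4 (smul_mem_positiveCone (by linarith [hv i]) h2)

/-- A linear function that is nonnegative on the normals and at a point `v` of the closed chamber
is bounded below on the nontrivial translates of `v` by its least increment along a single
reflection. -/
theorem le_apply_wordMap (h : IsCoxeterSystemOfNormals B e)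
    (φ : V →ₗ[ℝ] ℝ) (hφ : ∀ i, 0 ≤ φ (e i)) {v : V}
    (hv : ∀ i, B v (e i) ≤ 0) (hφv : 0 ≤ φ v) {κ : ℝ}
    (hκ : ∀ i, κ ≤ -2 * B v (e i) * φ (e i)) (l : List ι) (hl : wordMap B e l ≠ 1) :
    κ ≤ φ (wordMap B e l v) := by
  obtain ⟨n, hn⟩ : ∃ n, l.length ≤ n := ⟨_, le_rfl⟩
  induction n using Nat.strong_induction_on generalizing l with
  | _ n ih =>
    obtain ⟨u, i, h1, h2, h3⟩ := h.exists_eq_mul_formReflection l hl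
    have e1 : φ (wordMap B e l v) =
        φ (wordMap B e u v) + -2 * B v (e i) * φ (wordMap B e u (e i)) := by
      rw [h1, Module.End.mul_apply, formReflection_apply, map_sub, map_smul, map_sub, map_smul,
        smul_eq_mul]
      ring
    rw [e1]
    by_cases hu : wordMap B e u = 1
    · rw [hu, Module.End.one_apply, Module.End.one_apply]
      linarith [hκ i]
    · have h4 := ih u.length (by have := h3 l rfl; omega) u hu le_rfl
      have h5 := nonneg_of_mem_positiveCone φ hφ h2
      nlinarith [hv i, mul_nonneg (neg_nonneg.2 (hv i)) h5]

end IsCoxeterSystemOfNormals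

end

end Reflections

/-! ### The light cone model of the sphere -/

/-- The vector space that carries the Lorentzian form. -/
abbrev LorentzSpace := E4 × ℝ × ℝ

/-- The form `x ⬝ y - (a b' + b a') / 2` of signature `(5, 1)`. -/
noncomputable def lorentzForm : LinearMap.BilinForm ℝ LorentzSpace :=
  LinearMap.mk₂ ℝ (fun u v => inner ℝ u.1 v.1 - (u.2.1 * v.2.2 + u.2.2 * v.2.1) / 2)
    (fun u u' v => by simp [inner_add_left]; ring)
    (fun c u v => by simp [inner_smul_left]; ring)
    (fun u v v' => by simp [inner_add_right]; ring)
    (fun c u v => by simp [inner_smul_right]; ring)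

theorem lorentzForm_apply (u v : LorentzSpace) :
    lorentzForm u v = inner ℝ u.1 v.1 - (u.2.1 * v.2.2 + u.2.2 * v.2.1) / 2 := rfl

theorem lorentzForm_symm (u v : LorentzSpace) : lorentzForm u v = lorentzForm v u := by
  rw [lorentzForm_apply, lorentzForm_apply, real_inner_comm]
  ring

/-- The null vector that represents the point `∞`. -/
noncomputable def nullInfty : LorentzSpace := (0, 1, 0)

/-- The null vector with last coordinate `1` that represents a point of Euclidean space. -/
noncomputable def nullVector (x : E4) : LorentzSpace := (x, ‖x‖ ^ 2, 1)

/-- The null vector that represents a point of the sphere. -/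
noncomputable def lightCone (p : S4) : LorentzSpace := p.elim nullInfty nullVector

@[simp] theorem lightCone_infty : lightCone OnePoint.infty = nullInfty := rfl

@[simp] theorem lightCone_coe (x : E4) : lightCone (x : S4) = nullVector x := rfl

/-- The last coordinate of a vector; for a null vector that represents a point of the sphere, it is
the reciprocal of a conformal factor. -/
noncomputable def height : LorentzSpace →ₗ[ℝ] ℝ :=
  (LinearMap.snd ℝ ℝ ℝ).comp (LinearMap.snd ℝ E4 (ℝ × ℝ))

theorem height_apply (u : LorentzSpace) : height u = u.2.2 := rfl

theorem height_eq (u : LorentzSpace) : height u = -2 * lorentzForm u nullInfty := by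
  simp [height_apply, lorentzForm_apply, nullInfty]
  ring

@[simp] theorem height_nullVector (x : E4) : height (nullVector x) = 1 := rfl

@[simp] theorem height_nullInfty : height nullInfty = 0 := rfl

theorem lorentzForm_nullVector (x y : E4) :
    lorentzForm (nullVector x) (nullVector y) = -dist x y ^ 2 / 2 := by
  rw [lorentzForm_apply, dist_eq_norm, norm_sub_sq_real]
  simp only [nullVector]
  ring

/-- Different points of the sphere are represented by linearly independent vectors. -/
theorem lightCone_smul_injective {p q : S4} {μ : ℝ} (hμ : 0 < μ)
    (h : lightCone p = μ • lightCone q) : p = q := by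
  have hh := congrArg height h
  rw [map_smul, smul_eq_mul] at hh
  induction p using OnePoint.rec with
  | infty =>
    induction q using OnePoint.rec with
    | infty => rfl
    | coe y => simp [hμ.ne] at hh
  | coe x =>
    induction q using OnePoint.rec with
    | infty => simp at hh
    | coe y =>
      simp only [lightCone_coe, height_nullVector, mul_one] at hh
      rw [← hh, one_smul] at h
      exact congrArg _ (congrArg Prod.fst h)

namespace RoundBall

/-- The unit spacelike vector that represents the boundary sphere of a ball. -/
noncomputable def normal (B : RoundBall) : LorentzSpace :=
  B.radius⁻¹ • ((B.center, ‖B.center‖ ^ 2 - B.radius ^ 2, 1) : LorentzSpace)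

theorem lorentzForm_normal (A B : RoundBall) :
    lorentzForm A.normal B.normal =
      (A.radius ^ 2 + B.radius ^ 2 - dist A.center B.center ^ 2) / (2 * A.radius * B.radius) := by
  have := A.radius_pos
  have := B.radius_pos
  simp only [normal, map_smul, LinearMap.smul_apply, lorentzForm_apply, smul_eq_mul]
  rw [dist_eq_norm, norm_sub_sq_real]
  field_simp
  ring

theorem lorentzForm_normal_self (B : RoundBall) : lorentzForm B.normal B.normal = 1 := by
  have := B.radius_pos
  rw [lorentzForm_normal, dist_self]
  field_simp
  ring

theorem lorentzForm_nullVector_normal (B : RoundBall) (x : E4) :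
    lorentzForm (nullVector x) B.normal =
      (B.radius ^ 2 - dist x B.center ^ 2) / (2 * B.radius) := by
  have := B.radius_pos
  simp only [normal, map_smul, lorentzForm_apply, smul_eq_mul, nullVector]
  rw [dist_eq_norm, norm_sub_sq_real]
  field_simp
  ring

theorem lorentzForm_nullInfty_normal (B : RoundBall) :
    lorentzForm nullInfty B.normal = -1 / (2 * B.radius) := by
  have := B.radius_pos
  simp only [normal, map_smul, lorentzForm_apply, smul_eq_mul, nullInfty, inner_zero_left]
  field_simp
  ring

theorem height_normal (B : RoundBall) : height B.normal = B.radius⁻¹ := by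
  simp [normal, height_apply]

theorem inversion_apply (B : RoundBall) (p : S4) :
    B.inversion p = inversionFun B.center B.radius p := rfl

theorem inversion_mul_self (B : RoundBall) : B.inversion * B.inversion = 1 := by
  ext p
  exact inversionFun_involutive B.center B.radius_pos.ne' p

theorem inversion_inv (B : RoundBall) : B.inversion⁻¹ = B.inversion :=
  inv_eq_of_mul_eq_one_left B.inversion_mul_self

theorem formReflection_nullVector (B : RoundBall) {x : E4} (hx : x ≠ B.center) :
    formReflection lorentzForm B.normal (nullVector x) =
      (dist x B.center ^ 2 / B.radius ^ 2) •
        nullVector (EuclideanGeometry.inversion B.center B.radius x) := by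
  have hr := B.radius_pos
  have hd : 0 < dist x B.center := dist_pos.2 hx
  rw [formReflection_apply, lorentzForm_nullVector_normal, EuclideanGeometry.inversion]
  simp only [vsub_eq_sub, vadd_eq_add]
  have hn : dist x B.center ^ 2 = ‖x - B.center‖ ^ 2 := by rw [dist_eq_norm]
  generalize hD : dist x B.center = D at *
  generalize hR : B.radius = r at *
  have hx1 : x = (x - B.center) + B.center := by abel
  have hxn : ‖x‖ ^ 2 = D ^ 2 + 2 * inner ℝ (x - B.center) B.center + ‖B.center‖ ^ 2 := by
    conv_lhs => rw [hx1]
    rw [norm_add_sq_real, ← hn]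
  refine Prod.ext ?_ (Prod.ext ?_ ?_)
  · simp only [nullVector, normal, hR, Prod.fst_sub, Prod.smul_fst, smul_add, smul_smul]
    have e1 : D ^ 2 / r ^ 2 * (r / D) ^ 2 = 1 := by field_simp
    have e2 : 2 * ((r ^ 2 - D ^ 2) / (2 * r)) * r⁻¹ = 1 - D ^ 2 / r ^ 2 := by field_simp
    rw [e1, e2]
    module
  · simp only [nullVector, normal, hR, Prod.fst_sub, Prod.snd_sub, Prod.smul_snd, Prod.smul_fst,
      smul_eq_mul]
    rw [norm_add_sq_real, norm_smul, inner_smul_left, mul_pow, ← hn, hxn, Real.norm_eq_abs, sq_abs]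
    simp only [conj_trivial]
    field_simp
    ring
  · simp only [nullVector, normal, hR, Prod.snd_sub, Prod.smul_snd, smul_eq_mul]
    field_simp
    ring

/-- On the light cone, the reflection in the normal of a sphere is the inversion in that sphere, up
to positive factors. -/
theorem exists_formReflection_lightCone (B : RoundBall) (p : S4) :
    ∃ μ : ℝ, 0 < μ ∧
      formReflection lorentzForm B.normal (lightCone p) = μ • lightCone (B.inversion p) := by
  have hr := B.radius_pos
  rw [inversion_apply]
  induction p using OnePoint.rec with
  | infty =>
    refine ⟨(B.radius ^ 2)⁻¹, by positivity, ?_⟩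
    rw [inversionFun_infty, lightCone_infty, lightCone_coe, formReflection_apply,
      lorentzForm_nullInfty_normal]
    refine Prod.ext ?_ (Prod.ext ?_ ?_)
    · simp only [nullInfty, nullVector, normal, Prod.fst_sub, Prod.smul_fst, smul_smul, zero_sub,
        ← neg_smul]
      congr 1
      field_simp
    · simp only [nullInfty, nullVector, normal, Prod.fst_sub, Prod.snd_sub, Prod.smul_snd,
        Prod.smul_fst, smul_eq_mul]
      field_simp
      ring
    · simp only [nullInfty, nullVector, normal, Prod.snd_sub, Prod.smul_snd, smul_eq_mul]
      field_simp
      ring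
  | coe x =>
    by_cases hx : x = B.center
    · subst hx
      refine ⟨B.radius ^ 2, by positivity, ?_⟩
      rw [inversionFun_center, lightCone_infty, lightCone_coe, formReflection_apply,
        lorentzForm_nullVector_normal, dist_self]
      refine Prod.ext ?_ (Prod.ext ?_ ?_)
      · simp only [nullInfty, nullVector, normal, Prod.fst_sub, Prod.smul_fst, smul_smul, smul_zero]
        rw [sub_eq_zero]
        conv_lhs => rw [← one_smul ℝ B.center]
        congr 1
        field_simp
        ring
      · simp only [nullInfty, nullVector, normal, Prod.fst_sub, Prod.snd_sub, Prod.smul_snd,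
          Prod.smul_fst, smul_eq_mul]
        field_simp
        ring
      · simp only [nullInfty, nullVector, normal, Prod.snd_sub, Prod.smul_snd, smul_eq_mul]
        field_simp
        ring
    · have hd : 0 < dist x B.center := dist_pos.2 hx
      exact ⟨dist x B.center ^ 2 / B.radius ^ 2, by positivity, by
        rw [inversionFun_coe _ _ hx, lightCone_coe, lightCone_coe, B.formReflection_nullVector hx]⟩

theorem lorentzForm_lightCone_normal_pos (B : RoundBall) (p : S4) :
    0 < lorentzForm (lightCone p) B.normal ↔ p ∈ ((↑) : E4 → S4) '' B.ball := by
  have hr := B.radius_pos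
  induction p using OnePoint.rec with
  | infty =>
    rw [lightCone_infty, lorentzForm_nullInfty_normal]
    simp only [OnePoint.infty_notMem_image_coe, iff_false, not_lt]
    exact div_nonpos_of_nonpos_of_nonneg (by norm_num) (by positivity)
  | coe x =>
    rw [lightCone_coe, lorentzForm_nullVector_normal, OnePoint.coe_injective.mem_set_image, ball,
      Metric.mem_ball, div_pos_iff_of_pos_right (by positivity), sub_pos,
      sq_lt_sq₀ dist_nonneg hr.le]

theorem lorentzForm_lightCone_normal_neg (B : RoundBall) (p : S4) :
    lorentzForm (lightCone p) B.normal < 0 ↔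
      p ∉ ((↑) : E4 → S4) '' Metric.closedBall B.center B.radius := by
  have hr := B.radius_pos
  induction p using OnePoint.rec with
  | infty =>
    rw [lightCone_infty, lorentzForm_nullInfty_normal]
    simp only [OnePoint.infty_notMem_image_coe, not_false_eq_true, iff_true]
    exact div_neg_of_neg_of_pos (by norm_num) (by positivity)
  | coe x =>
    rw [lightCone_coe, lorentzForm_nullVector_normal, OnePoint.coe_injective.mem_set_image,
      Metric.mem_closedBall, not_le, div_neg_iff, sub_neg, sq_lt_sq₀ hr.le dist_nonneg]
    constructor
    · rintro (h | h)
      · linarith [h.2]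
      · exact h.1
    · exact fun h => Or.inr ⟨h, by positivity⟩

end RoundBall

/-! ### The group generated by the inversions in a Coxeter system of spheres -/

section InversionGroup

variable {ι : Type*}

/-- The product of the inversions spelled by a word in the index set. -/
noncomputable def inversionWord (B : ι → RoundBall) (l : List ι) : S4 ≃ₜ S4 :=
  (l.map fun i => (B i).inversion).prod

/-- The complement of a union of open round balls in the sphere. -/
def exteriorDomain (B : ι → RoundBall) : Set S4 := (⋃ i, ((↑) : E4 → S4) '' (B i).ball)ᶜ

variable {B : ι → RoundBall}

@[simp] theorem inversionWord_nil : inversionWord B [] = 1 := rfl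

@[simp] theorem inversionWord_cons (i : ι) (l : List ι) :
    inversionWord B (i :: l) = (B i).inversion * inversionWord B l := by
  simp [inversionWord]

@[simp] theorem inversionWord_append (l l' : List ι) :
    inversionWord B (l ++ l') = inversionWord B l * inversionWord B l' := by
  simp [inversionWord]

theorem inversionWord_reverse (l : List ι) :
    inversionWord B l.reverse = (inversionWord B l)⁻¹ := by
  induction l with
  | nil => simp
  | cons i l ih => simp [ih, RoundBall.inversion_inv]

theorem inversionWord_mem_closure (l : List ι) :
    inversionWord B l ∈ Subgroup.closure (range fun i => (B i).inversion) := by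
  induction l with
  | nil => exact one_mem _
  | cons i l ih =>
    rw [inversionWord_cons]
    exact mul_mem (Subgroup.subset_closure ⟨i, rfl⟩) ih

theorem exists_inversionWord_eq {g : S4 ≃ₜ S4}
    (hg : g ∈ Subgroup.closure (range fun i => (B i).inversion)) :
    ∃ l, inversionWord B l = g := by
  induction hg using Subgroup.closure_induction with
  | mem x hx => obtain ⟨i, rfl⟩ := hx; exact ⟨[i], by simp⟩
  | one => exact ⟨[], rfl⟩
  | mul x y _ _ hx hy =>
    obtain ⟨l, rfl⟩ := hx
    obtain ⟨l', rfl⟩ := hy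
    exact ⟨l ++ l', by simp⟩
  | inv x _ hx =>
    obtain ⟨l, rfl⟩ := hx
    exact ⟨l.reverse, inversionWord_reverse l⟩

theorem exists_wordMap_lightCone (l : List ι) (p : S4) :
    ∃ μ : ℝ, 0 < μ ∧ wordMap lorentzForm (fun i => (B i).normal) l (lightCone p) =
      μ • lightCone (inversionWord B l p) := by
  induction l with
  | nil => exact ⟨1, one_pos, by simp⟩
  | cons i l ih =>
    obtain ⟨μ, hμ, h1⟩ := ih
    obtain ⟨ν, hν, h2⟩ := (B i).exists_formReflection_lightCone (inversionWord B l p)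
    refine ⟨μ * ν, mul_pos hμ hν, ?_⟩
    rw [wordMap_cons, Module.End.mul_apply, h1, map_smul, h2, smul_smul, inversionWord_cons]
    rfl

theorem mem_exteriorDomain {p : S4} :
    p ∈ exteriorDomain B ↔ ∀ i, lorentzForm (lightCone p) (B i).normal ≤ 0 := by
  simp only [exteriorDomain, mem_compl_iff, mem_iUnion, not_exists,
    ← RoundBall.lorentzForm_lightCone_normal_pos, not_lt]

theorem mem_interior_exteriorDomain [Finite ι] {p : S4} :
    p ∈ interior (exteriorDomain B) ↔ ∀ i, lorentzForm (lightCone p) (B i).normal < 0 := by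
  simp only [RoundBall.lorentzForm_lightCone_normal_neg]
  constructor
  · intro hp i hpi
    have h1 : closure (((↑) : E4 → S4) '' (B i).ball) ⊆ (interior (exteriorDomain B))ᶜ := by
      rw [← closure_compl]
      refine closure_mono ?_
      rw [exteriorDomain, compl_compl]
      exact subset_iUnion (fun i => ((↑) : E4 → S4) '' (B i).ball) i
    rw [← closure_ball _ (B i).radius_pos.ne'] at hpi
    exact h1 (image_closure_subset_closure_image OnePoint.continuous_coe hpi) hp
  · intro hp
    have ho : IsOpen (⋃ i, ((↑) : E4 → S4) '' Metric.closedBall (B i).center (B i).radius)ᶜ :=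
      (isClosed_iUnion_of_finite fun i =>
        ((isCompact_closedBall _ _).image OnePoint.continuous_coe).isClosed).isOpen_compl
    refine interior_maximal (compl_subset_compl.2 (iUnion_mono fun i => ?_)) ho
      (by simpa using hp)
    exact image_mono Metric.ball_subset_closedBall

theorem infty_mem_interior_exteriorDomain [Finite ι] :
    OnePoint.infty ∈ interior (exteriorDomain B) := by
  rw [mem_interior_exteriorDomain]
  intro i
  rw [lightCone_infty, RoundBall.lorentzForm_nullInfty_normal]
  exact div_neg_of_neg_of_pos (by norm_num) (mul_pos two_pos (B i).radius_pos)

namespace IsCoxeterSystemOfNormals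

theorem inversionWord_notMem [Finite ι]
    (h : IsCoxeterSystemOfNormals lorentzForm fun i => (B i).normal) {l : List ι}
    (hl : wordMap lorentzForm (fun i => (B i).normal) l ≠ 1) {p : S4}
    (hp : p ∈ interior (exteriorDomain B)) : inversionWord B l p ∉ exteriorDomain B := by
  obtain ⟨i, hi⟩ := h.exists_form_wordMap_pos l hl
  have h1 := hi (lightCone p) (mem_interior_exteriorDomain.1 hp)
  obtain ⟨μ, hμ, h2⟩ := exists_wordMap_lightCone (B := B) l p
  rw [h2, map_smul, LinearMap.smul_apply, smul_eq_mul] at h1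
  intro h3
  exact (pos_of_mul_pos_right h1 hμ.le).not_ge (mem_exteriorDomain.1 h3 i)

theorem wordMap_eq_one_iff [Finite ι]
    (h : IsCoxeterSystemOfNormals lorentzForm fun i => (B i).normal) (l : List ι) :
    wordMap lorentzForm (fun i => (B i).normal) l = 1 ↔ inversionWord B l = 1 := by
  constructor
  · intro hl
    ext p
    obtain ⟨μ, hμ, h2⟩ := exists_wordMap_lightCone (B := B) l p
    rw [hl] at h2
    exact (lightCone_smul_injective hμ h2).symm
  · intro hl
    by_contra h1
    refine h.inversionWord_notMem h1 infty_mem_interior_exteriorDomain ?_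
    rw [hl]
    exact interior_subset infty_mem_interior_exteriorDomain

/-- A nontrivial group element maps no point of the closed domain into its interior. -/
theorem eq_one_of_mem_interior [Finite ι]
    (h : IsCoxeterSystemOfNormals lorentzForm fun i => (B i).normal) {g : S4 ≃ₜ S4}
    (hg : g ∈ Subgroup.closure (range fun i => (B i).inversion)) {p : S4}
    (hp : p ∈ exteriorDomain B) (hgp : g p ∈ interior (exteriorDomain B)) : g = 1 := by
  obtain ⟨l, rfl⟩ := exists_inversionWord_eq hg
  by_contra h1
  refine h.inversionWord_notMem (l := l.reverse) ?_ hgp ?_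
  · rw [ne_eq, h.wordMap_eq_one_iff, inversionWord_reverse, inv_eq_one]
    exact h1
  · rw [inversionWord_reverse]
    change ((inversionWord B l)⁻¹ * inversionWord B l) p ∈ _
    rwa [inv_mul_cancel]

theorem isDiscreteReflectionGroup [Finite ι]
    (h : IsCoxeterSystemOfNormals lorentzForm fun i => (B i).normal) :
    IsDiscreteReflectionGroup (Subgroup.closure (range fun i => (B i).inversion)) where
  le_mob := Subgroup.closure_mono (by rintro _ ⟨i, rfl⟩; exact ⟨B i, rfl⟩)
  generated := ⟨_, by rintro _ ⟨i, rfl⟩; exact ⟨B i, rfl⟩, rfl⟩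
  discrete := by
    -- an element is isolated by the condition that it maps `∞` into an open translate
    rw [discreteTopology_iff_isOpen_singleton]
    rintro ⟨g, hg⟩
    have hev : Continuous fun f : S4 ≃ₜ S4 => f OnePoint.infty :=
      (continuous_eval_const (F := C(S4, S4)) OnePoint.infty).comp
        (continuous_induced_dom (f := fun g : S4 ≃ₜ S4 => (g : C(S4, S4))))
    have ho : IsOpen {f : Subgroup.closure (range fun i => (B i).inversion) |
        g⁻¹ ((f : S4 ≃ₜ S4) OnePoint.infty) ∈ interior (exteriorDomain B)} :=
      isOpen_interior.preimage ((g⁻¹).continuous.comp (hev.comp continuous_subtype_val))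
    convert ho
    ext ⟨f, hf⟩
    simp only [mem_singleton_iff, mem_ofPred_eq, Subtype.mk.injEq]
    constructor
    · rintro rfl
      change (f⁻¹ * f) OnePoint.infty ∈ _
      rw [inv_mul_cancel]
      exact infty_mem_interior_exteriorDomain
    · intro h1
      have := h.eq_one_of_mem_interior (mul_mem (inv_mem hg) hf)
        (interior_subset infty_mem_interior_exteriorDomain) h1
      exact (inv_mul_eq_one.1 this).symm

/-- The image of `∞` under a nontrivial element `g⁻¹` lies in one of the balls. -/
theorem exists_wordMap_reverse_nullInfty [Finite ι]
    (h : IsCoxeterSystemOfNormals lorentzForm fun i => (B i).normal) {l : List ι}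
    (hl : wordMap lorentzForm (fun i => (B i).normal) l ≠ 1) :
    ∃ a ∈ ⋃ i, (B i).ball, ∃ μ : ℝ, 0 < μ ∧
      wordMap lorentzForm (fun i => (B i).normal) l.reverse nullInfty = μ • nullVector a ∧
      (inversionWord B l)⁻¹ OnePoint.infty = a := by
  obtain ⟨μ, hμ, h2⟩ := exists_wordMap_lightCone (B := B) l.reverse OnePoint.infty
  have hl' : wordMap lorentzForm (fun i => (B i).normal) l.reverse ≠ 1 := by
    rwa [ne_eq, h.wordMap_eq_one_iff, inversionWord_reverse, inv_eq_one, ← h.wordMap_eq_one_iff]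
  have h3 := h.inversionWord_notMem hl' infty_mem_interior_exteriorDomain
  rw [exteriorDomain, mem_compl_iff, not_not, mem_iUnion] at h3
  obtain ⟨i, a, ha, hia⟩ := h3
  refine ⟨a, mem_iUnion.2 ⟨i, ha⟩, μ, hμ, ?_, ?_⟩
  · rw [← lightCone_infty, h2, ← hia, lightCone_coe]
  · rw [← inversionWord_reverse, hia]

/-- The height of the image of `nullVector x` under `g` is `|x - g⁻¹ ∞|²` divided by the square of
the radius of the isometric sphere of `g`. -/
theorem height_wordMap_nullVector
    (h : IsCoxeterSystemOfNormals lorentzForm fun i => (B i).normal) {l : List ι} {a : E4} {μ : ℝ}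
    (hl : wordMap lorentzForm (fun i => (B i).normal) l.reverse nullInfty = μ • nullVector a)
    (x : E4) : height (wordMap lorentzForm (fun i => (B i).normal) l (nullVector x)) =
      μ * dist x a ^ 2 := by
  rw [height_eq, h.form_wordMap, hl, map_smul, lorentzForm_nullVector, smul_eq_mul]
  ring

/-- Only finitely many group elements have an isometric sphere whose radius is bounded below,
because the centers of these spheres are uniformly separated from each other. -/
theorem finite_height_le [Finite ι]
    (h : IsCoxeterSystemOfNormals lorentzForm fun i => (B i).normal) (C : ℝ) :
    {g | ∃ l, inversionWord B l = g ∧ ∃ a ∈ ⋃ i, (B i).ball, ∃ μ : ℝ, 0 < μ ∧ μ ≤ C ∧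
      wordMap lorentzForm (fun i => (B i).normal) l.reverse nullInfty =
        μ • nullVector a}.Finite := by
  obtain ⟨κ, hκ0, hκ⟩ : ∃ κ : ℝ, 0 < κ ∧ ∀ i,
      κ ≤ -2 * lorentzForm nullInfty (B i).normal * height (B i).normal := by
    obtain ⟨R, hR⟩ := (finite_range fun i => (B i).radius).bddAbove
    refine ⟨(max R 1 ^ 2)⁻¹, by positivity, fun i => ?_⟩
    have h1 : (B i).radius ≤ max R 1 := (hR ⟨i, rfl⟩).trans (le_max_left _ _)
    have h0 := (B i).radius_pos
    have e : -2 * lorentzForm nullInfty (B i).normal * height (B i).normal =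
        ((B i).radius ^ 2)⁻¹ := by
      rw [RoundBall.lorentzForm_nullInfty_normal, RoundBall.height_normal]
      field_simp
    rw [e]
    gcongr
  have hsep : ∀ l l' : List ι, inversionWord B l ≠ inversionWord B l' → ∀ a a' : E4,
      ∀ μ μ' : ℝ, wordMap lorentzForm (fun i => (B i).normal) l.reverse nullInfty =
        μ • nullVector a →
      wordMap lorentzForm (fun i => (B i).normal) l'.reverse nullInfty = μ' • nullVector a' →
      κ ≤ μ * μ' * dist a a' ^ 2 := by
    intro l l' hne a a' μ μ' h1 h2
    have hw : wordMap lorentzForm (fun i => (B i).normal) (l ++ l'.reverse) ≠ 1 := by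
      rw [ne_eq, h.wordMap_eq_one_iff, inversionWord_append, inversionWord_reverse,
        mul_inv_eq_one]
      exact hne
    have h3 := h.le_apply_wordMap height
      (fun i => by rw [RoundBall.height_normal]; exact (inv_pos.2 (B i).radius_pos).le)
      (v := nullInfty) (fun i => ?_) (by simp) hκ _ hw
    · rw [wordMap_append, Module.End.mul_apply, h2, map_smul, map_smul,
        h.height_wordMap_nullVector h1, smul_eq_mul, dist_comm] at h3
      linarith
    · rw [RoundBall.lorentzForm_nullInfty_normal]
      exact div_nonpos_of_nonpos_of_nonneg (by norm_num)
        (mul_nonneg two_pos.le (B i).radius_pos.le)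
  -- otherwise two of the separated points share a small ball of a finite cover
  rw [← not_infinite]
  intro hinf
  choose! l hl a ha μ hμ hμC hw using fun g (hg : g ∈ {g | ∃ l, inversionWord B l = g ∧
    ∃ a ∈ ⋃ i, (B i).ball, ∃ μ : ℝ, 0 < μ ∧ μ ≤ C ∧
      wordMap lorentzForm (fun i => (B i).normal) l.reverse nullInfty = μ • nullVector a}) => hg
  have hC : 0 < C := by
    obtain ⟨g, hg⟩ := hinf.nonempty
    exact (hμ g hg).trans_le (hμC g hg)
  have hb : Bornology.IsBounded (⋃ i, (B i).ball) :=
    Bornology.isBounded_iUnion.2 fun i => Metric.isBounded_ball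
  set δ := Real.sqrt κ / C with hδ
  have hδ0 : 0 < δ := div_pos (Real.sqrt_pos.2 hκ0) hC
  obtain ⟨t, ht, hcov⟩ := Metric.totallyBounded_iff.1
    (hb.isCompact_closure.totallyBounded.subset subset_closure) (δ / 2) (half_pos hδ0)
  have hc : ∀ g ∈ {g | ∃ l, inversionWord B l = g ∧ ∃ a ∈ ⋃ i, (B i).ball, ∃ μ : ℝ, 0 < μ ∧
      μ ≤ C ∧ wordMap lorentzForm (fun i => (B i).normal) l.reverse nullInfty =
        μ • nullVector a}, ∃ y ∈ t, a g ∈ Metric.ball y (δ / 2) := by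
    intro g hg
    simpa using hcov (ha g hg)
  choose! y hyt hy using hc
  obtain ⟨g, hg, g', hg', hne, heq⟩ := hinf.exists_ne_map_eq_of_mapsTo hyt ht
  have h1 := hsep (l g) (l g') (by rwa [hl g hg, hl g' hg']) _ _ _ _ (hw g hg) (hw g' hg')
  have h2 : dist (a g) (a g') < δ := by
    have e1 := Metric.mem_ball.1 (hy g hg)
    have e2 := Metric.mem_ball'.1 (hy g' hg')
    rw [heq] at e1
    linarith [dist_triangle (a g) (y g') (a g')]
  have h3 : dist (a g) (a g') ^ 2 < δ ^ 2 := by gcongr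
  have h4 : C * C * δ ^ 2 = κ := by
    rw [hδ, div_pow, Real.sq_sqrt hκ0.le]
    field_simp
  have h5 : μ g * μ g' ≤ C * C :=
    mul_le_mul (hμC g hg) (hμC g' hg') (hμ g' hg').le hC.le
  have h6 : μ g * μ g' * dist (a g) (a g') ^ 2 ≤ C * C * dist (a g) (a g') ^ 2 :=
    mul_le_mul_of_nonneg_right h5 (sq_nonneg _)
  have h7 : C * C * dist (a g) (a g') ^ 2 < C * C * δ ^ 2 :=
    mul_lt_mul_of_pos_left h3 (mul_pos hC hC)
  linarith

/-- Near a point of the domain of discontinuity, only finitely many group elements fail to contract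
Euclidean lengths somewhere. -/
theorem exists_finite_height_le_one [Finite ι]
    (h : IsCoxeterSystemOfNormals lorentzForm fun i => (B i).normal) {x₀ : E4}
    (hx₀ : (x₀ : S4) ∈ domainOfDiscontinuity
      (Subgroup.closure (range fun i => (B i).inversion))) :
    ∃ ε > 0, {g | ∃ l, inversionWord B l = g ∧ ∃ x ∈ Metric.ball x₀ ε,
      height (wordMap lorentzForm (fun i => (B i).normal) l (nullVector x)) ≤ 1}.Finite := by
  obtain ⟨U, hU, hfin⟩ := hx₀
  obtain ⟨ε, hε, hεU⟩ := Metric.mem_nhds_iff.1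
    (OnePoint.continuous_coe.continuousAt.preimage_mem_nhds hU)
  -- if `g⁻¹ ∞` is near `x₀`, then `g` belongs to a finite set
  have hF : {g | g ∈ Subgroup.closure (range fun i => (B i).inversion) ∧
      g⁻¹ OnePoint.infty ∈ U}.Finite := by
    rcases Set.eq_empty_or_nonempty {g | g ∈ Subgroup.closure (range fun i => (B i).inversion) ∧
      g⁻¹ OnePoint.infty ∈ U} with h0 | ⟨g₀, hg₀, hgU₀⟩
    · rw [h0]
      exact finite_empty
    · refine (hfin.image fun f => g₀ * f⁻¹).subset ?_
      rintro g ⟨hg, hgU⟩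
      refine ⟨g⁻¹ * g₀, ⟨mul_mem (inv_mem hg) hg₀, g⁻¹ OnePoint.infty,
        ⟨g₀⁻¹ OnePoint.infty, hgU₀, ?_⟩, hgU⟩, by simp⟩
      change (g⁻¹ * g₀ * g₀⁻¹) OnePoint.infty = _
      rw [mul_inv_cancel_right]
  refine ⟨ε / 2, half_pos hε,
    ((hF.union (h.finite_height_le ((ε / 2) ^ 2)⁻¹)).union (finite_singleton 1)).subset ?_⟩
  rintro _ ⟨l, rfl, x, hx, hle⟩
  by_cases hl : wordMap lorentzForm (fun i => (B i).normal) l = 1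
  · exact Or.inr ((h.wordMap_eq_one_iff l).1 hl)
  left
  obtain ⟨a, ha, μ, hμ, hw, hinf⟩ := h.exists_wordMap_reverse_nullInfty hl
  rw [h.height_wordMap_nullVector hw] at hle
  rcases lt_or_ge (dist x a) (ε / 2) with hd | hd
  · refine Or.inl ⟨inversionWord_mem_closure l, ?_⟩
    rw [hinf]
    apply hεU
    rw [Metric.mem_ball] at hx ⊢
    linarith [dist_triangle_left a x₀ x]
  · refine Or.inr ⟨l, rfl, a, ha, μ, hμ, ?_, hw⟩
    rw [← one_div, le_div_iff₀ (by positivity)]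
    refine le_trans ?_ hle
    gcongr

/-- A null vector in the closed chamber has the least height in its orbit; here it is compared with
`nullVector x`. -/
theorem height_wordMap_le_one
    (h : IsCoxeterSystemOfNormals lorentzForm fun i => (B i).normal) {l : List ι} {x : E4}
    (hx : inversionWord B l x ∈ exteriorDomain B) :
    height (wordMap lorentzForm (fun i => (B i).normal) l (nullVector x)) ≤ 1 := by
  obtain ⟨μ, hμ, h2⟩ := exists_wordMap_lightCone (B := B) l x
  have h1 := h.wordMap_sub_mem_positiveCone l.reverse
    (v := wordMap lorentzForm (fun i => (B i).normal) l (nullVector x)) fun i => by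
      rw [← lightCone_coe, h2, map_smul, LinearMap.smul_apply, smul_eq_mul]
      exact mul_nonpos_of_nonneg_of_nonpos hμ.le (mem_exteriorDomain.1 hx i)
  rw [← Module.End.mul_apply, h.wordMap_reverse_mul, Module.End.one_apply] at h1
  have h3 := nonneg_of_mem_positiveCone height
    (fun i => by rw [RoundBall.height_normal]; exact (inv_pos.2 (B i).radius_pos).le) h1
  rw [map_sub, height_nullVector] at h3
  linarith

/-- Poincaré's theorem for the inversions in a Coxeter system of spheres. -/
theorem isKleinianFundamentalDomain [Finite ι]
    (h : IsCoxeterSystemOfNormals lorentzForm fun i => (B i).normal)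
    (hcl : exteriorDomain B ⊆ closure (interior (exteriorDomain B))) :
    IsKleinianFundamentalDomain (Subgroup.closure (range fun i => (B i).inversion))
      (exteriorDomain B) where
  closure_interior := by
    refine Subset.antisymm (closure_minimal interior_subset ?_) hcl
    refine (isOpen_iUnion fun i => ?_).isClosed_compl
    exact OnePoint.isOpenEmbedding_coe.isOpenMap _ Metric.isOpen_ball
  disjoint := by
    intro g hg hg1
    rw [Set.disjoint_left]
    rintro _ ⟨p, hp, rfl⟩ hgp
    exact hg1 (h.eq_one_of_mem_interior hg (interior_subset hp) hgp)
  covers := by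
    intro p hp
    induction p using OnePoint.rec with
    | infty =>
      exact mem_biUnion (one_mem _)
        ⟨OnePoint.infty, interior_subset infty_mem_interior_exteriorDomain, rfl⟩
    | coe x =>
      -- an element that minimizes the height of the image of `x` moves `x` into the domain
      obtain ⟨ε, hε, hfin⟩ := h.exists_finite_height_le_one hp
      set S := {g | ∃ l, inversionWord B l = g ∧ ∃ y ∈ Metric.ball x ε,
        height (wordMap lorentzForm (fun i => (B i).normal) l (nullVector y)) ≤ 1}
      have hword : ∀ l l' : List ι, inversionWord B l = inversionWord B l' →
          wordMap lorentzForm (fun i => (B i).normal) l =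
            wordMap lorentzForm (fun i => (B i).normal) l' := by
        intro l l' hll
        have h1 := (h.wordMap_eq_one_iff (l ++ l'.reverse)).2 (by
          rw [inversionWord_append, inversionWord_reverse, hll, mul_inv_cancel])
        rw [wordMap_append] at h1
        have h2 := congrArg (· * wordMap lorentzForm (fun i => (B i).normal) l') h1
        simpa only [mul_assoc, h.wordMap_reverse_mul, mul_one, one_mul] using h2
      have hx : x ∈ Metric.ball x ε := Metric.mem_ball_self hε
      have h1S : (1 : S4 ≃ₜ S4) ∈ S := ⟨[], rfl, x, hx, by simp⟩
      choose! w hw using fun g (hg : g ∈ S) => (⟨hg.choose, hg.choose_spec.1⟩ :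
        ∃ l, inversionWord B l = g)
      obtain ⟨g, hgS, hmin⟩ := S.exists_min_image (fun g =>
        height (wordMap lorentzForm (fun i => (B i).normal) (w g) (nullVector x))) hfin ⟨1, h1S⟩
      have hmin1 : height (wordMap lorentzForm (fun i => (B i).normal) (w g) (nullVector x)) ≤ 1 :=
        (hmin 1 h1S).trans_eq (by rw [hword (w 1) [] (hw 1 h1S)]; simp)
      have hmem : g x ∈ exteriorDomain B := by
        rw [mem_exteriorDomain]
        intro i
        by_contra! hpos
        obtain ⟨μ, hμ, h2⟩ := exists_wordMap_lightCone (B := B) (w g) x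
        rw [hw g hgS, lightCone_coe] at h2
        have hdec : height (wordMap lorentzForm (fun i => (B i).normal) (i :: w g)
            (nullVector x)) <
            height (wordMap lorentzForm (fun i => (B i).normal) (w g) (nullVector x)) := by
          rw [wordMap_cons, Module.End.mul_apply, h2, map_smul, map_smul, map_smul, smul_eq_mul,
            smul_eq_mul, formReflection_apply, map_sub, map_smul, smul_eq_mul,
            RoundBall.height_normal]
          refine mul_lt_mul_of_pos_left ?_ hμ
          have := inv_pos.2 (B i).radius_pos
          have := mul_pos (mul_pos two_pos hpos) this
          linarith
        have hS : inversionWord B (i :: w g) ∈ S := ⟨_, rfl, x, hx, hdec.le.trans hmin1⟩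
        refine (hmin _ hS).not_gt ?_
        rwa [hword _ _ (hw _ hS)]
      obtain ⟨l, hl, -⟩ := hgS
      refine mem_biUnion (x := g⁻¹) (inv_mem (hl ▸ inversionWord_mem_closure l)) ⟨g x, hmem, ?_⟩
      change (g⁻¹ * g) x = _
      rw [inv_mul_cancel]
      rfl
  locally_finite := by
    intro p hp
    induction p using OnePoint.rec with
    | infty =>
      refine ⟨interior (exteriorDomain B),
        isOpen_interior.mem_nhds infty_mem_interior_exteriorDomain,
        (finite_singleton 1).subset ?_⟩
      rintro g ⟨hg, _, ⟨q, hq, rfl⟩, hgq⟩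
      exact h.eq_one_of_mem_interior hg hq hgq
    | coe x =>
      obtain ⟨ε, hε, hfin⟩ := h.exists_finite_height_le_one hp
      refine ⟨((↑) : E4 → S4) '' Metric.ball x ε,
        OnePoint.isOpenEmbedding_coe.image_mem_nhds.2 (Metric.ball_mem_nhds x hε),
        (hfin.image fun g => g⁻¹).subset ?_⟩
      rintro g ⟨hg, _, ⟨q, hq, rfl⟩, y, hy, hyq⟩
      obtain ⟨l, hl⟩ := exists_inversionWord_eq hg
      refine ⟨g⁻¹, ⟨l.reverse, by rw [inversionWord_reverse, hl], y, hy,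
        h.height_wordMap_le_one ?_⟩, inv_inv g⟩
      rw [inversionWord_reverse, hl, hyq]
      change (g⁻¹ * g) q ∈ _
      rwa [inv_mul_cancel]

end IsCoxeterSystemOfNormals

end InversionGroup

/-! ### Incidence and distance of cells -/

namespace GridCell

section

variable {n : ℕ}

/-- Twice the center of a cell, as an integer vector. -/
def doubledCenter (C : GridCell n) (j : Fin n) : ℤ := 2 * C.base j + if j ∈ C.dirs then 1 else 0

theorem doubledCenter_cast (C : GridCell n) (j : Fin n) :
    (C.doubledCenter j : ℝ) = 2 * C.center j := by
  rw [center_apply, doubledCenter]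
  split_ifs <;> push_cast <;> ring

/-- The excess of the squared distance of two doubled centers in a coordinate over the value that
it has if the first cell is a face of the second one. -/
def faceDefect (C D : GridCell n) (j : Fin n) : ℤ :=
  (C.doubledCenter j - D.doubledCenter j) ^ 2 -
    ((if j ∈ D.dirs then 1 else 0) - if j ∈ C.dirs then 1 else 0)

theorem faceDefect_nonneg (C D : GridCell n) (j : Fin n) : 0 ≤ faceDefect C D j := by
  have key : ∀ z : ℤ, 0 ≤ z * (z - 1) := fun z => by
    rcases le_or_gt z 0 with h | h
    · nlinarith
    · nlinarith
  simp only [faceDefect, doubledCenter]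
  have := key (C.base j - D.base j)
  split_ifs <;> nlinarith [sq_nonneg (C.base j - D.base j),
    sq_nonneg (2 * C.base j + 1 - (2 * D.base j + 0))]

theorem even_faceDefect (C D : GridCell n) (j : Fin n) : Even (faceDefect C D j) := by
  simp only [faceDefect, doubledCenter]
  split_ifs <;> simp [Int.even_sub, Int.even_pow]
  · exact Odd.pow ⟨C.base j - D.base j, by ring⟩
  · exact Odd.pow ⟨C.base j - D.base j - 1, by ring⟩

theorem isFace_of_faceDefect_eq_zero {C D : GridCell n} (h : ∀ j, faceDefect C D j = 0) :
    C.IsFace D := by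
  intro x hx
  have key : ∀ j, (j ∈ D.dirs → x j ∈ Icc (D.base j : ℝ) (D.base j + 1)) ∧
      (j ∉ D.dirs → x j = D.base j) := by
    intro j
    have hj := h j
    simp only [faceDefect, doubledCenter] at hj
    by_cases hC : j ∈ C.dirs <;> by_cases hD : j ∈ D.dirs <;>
      simp only [hC, hD, if_true, if_false] at hj
    · have e : C.base j = D.base j := by nlinarith [sq_nonneg (C.base j - D.base j)]
      exact ⟨fun _ => e ▸ hx.1 j hC, fun h' => absurd hD h'⟩
    · nlinarith [sq_nonneg (2 * C.base j + 1 - (2 * D.base j + 0))]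
    · have e : (C.base j - D.base j) * (C.base j - D.base j - 1) = 0 := by nlinarith
      refine ⟨fun _ => ?_, fun h' => absurd hD h'⟩
      rw [hx.2 j hC]
      rcases mul_eq_zero.1 e with e | e
      · rw [sub_eq_zero.1 e]
        exact ⟨le_rfl, by linarith⟩
      · have : C.base j = D.base j + 1 := by linarith
        rw [this]
        push_cast
        exact ⟨by linarith, le_rfl⟩
    · have e : C.base j = D.base j := by nlinarith [sq_nonneg (C.base j - D.base j)]
      exact ⟨fun h' => absurd h' hD, fun _ => e ▸ hx.2 j hC⟩
  exact ⟨fun j => (key j).1, fun j => (key j).2⟩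

theorem faceDefect_eq_zero_of_isFace {C D : GridCell n} (h : C.IsFace D) (j : Fin n) :
    faceDefect C D j = 0 := by
  have hc := h C.center_mem_carrier
  simp only [faceDefect, doubledCenter]
  by_cases hD : j ∈ D.dirs
  · have h1 := hc.1 j hD
    rw [center_apply] at h1
    by_cases hC : j ∈ C.dirs <;> simp only [hC, hD, if_true, if_false] at h1 ⊢
    · have a1 : (D.base j : ℝ) < C.base j + 1 := by linarith [h1.1]
      have a2 : (C.base j : ℝ) < D.base j + 1 := by linarith [h1.2]
      have b1 : D.base j < C.base j + 1 := by exact_mod_cast a1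
      have b2 : C.base j < D.base j + 1 := by exact_mod_cast a2
      have : C.base j = D.base j := by omega
      rw [this]
      ring
    · have a1 : (D.base j : ℝ) ≤ C.base j := by linarith [h1.1]
      have a2 : (C.base j : ℝ) ≤ D.base j + 1 := by linarith [h1.2]
      have b1 : D.base j ≤ C.base j := by exact_mod_cast a1
      have b2 : C.base j ≤ D.base j + 1 := by exact_mod_cast a2
      obtain h | h : C.base j = D.base j ∨ C.base j = D.base j + 1 := by omega
      · rw [h]
        ring
      · rw [h]
        ring
  · have h1 := hc.2 j hD
    rw [center_apply] at h1
    by_cases hC : j ∈ C.dirs <;> simp only [hC, hD, if_true, if_false] at h1 ⊢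
    · exfalso
      have a1 : (2 * C.base j + 1 : ℝ) = 2 * D.base j := by linarith
      have : 2 * C.base j + 1 = 2 * D.base j := by exact_mod_cast a1
      omega
    · have : C.base j = D.base j := by
        have : (C.base j : ℝ) = D.base j := by linarith
        exact_mod_cast this
      rw [this]
      ring

theorem four_mul_dist_center_sq (C D : GridCell n) :
    4 * dist C.center D.center ^ 2 =
      ((∑ j, (C.doubledCenter j - D.doubledCenter j) ^ 2 : ℤ) : ℝ) := by
  rw [EuclideanSpace.dist_eq, Real.sq_sqrt (Finset.sum_nonneg fun _ _ => sq_nonneg _),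
    Finset.mul_sum]
  push_cast
  refine Finset.sum_congr rfl fun j _ => ?_
  rw [doubledCenter_cast, doubledCenter_cast, Real.dist_eq, sq_abs]
  ring

theorem four_mul_dist_center_sq_eq (C D : GridCell n) :
    4 * dist C.center D.center ^ 2 =
      ((∑ j, faceDefect C D j : ℤ) : ℝ) + ((D.dim : ℝ) - C.dim) := by
  have h : (∑ j, (C.doubledCenter j - D.doubledCenter j) ^ 2 : ℤ) =
      ∑ j, faceDefect C D j + ((D.dim : ℤ) - C.dim) := by
    simp only [faceDefect, Finset.sum_sub_distrib, dim]
    simp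
  rw [four_mul_dist_center_sq, h]
  push_cast
  ring

theorem IsFace.four_mul_dist_center_sq {C D : GridCell n} (h : C.IsFace D) :
    4 * dist C.center D.center ^ 2 = (D.dim : ℝ) - C.dim := by
  rw [four_mul_dist_center_sq_eq, Finset.sum_eq_zero fun j _ => faceDefect_eq_zero_of_isFace h j]
  simp

/-- The squared distance of the doubled centers has the parity of the difference of the dimensions,
so that it exceeds this difference by at least `2` unless the cells are incident. -/
theorem le_four_mul_dist_center_sq {C D : GridCell n} (h : ¬ C.IsFace D) :
    (D.dim : ℝ) - C.dim + 2 ≤ 4 * dist C.center D.center ^ 2 := by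
  have h1 : 0 ≤ ∑ j, faceDefect C D j := Finset.sum_nonneg fun j _ => faceDefect_nonneg C D j
  have h2 : ∑ j, faceDefect C D j ≠ 0 := fun h0 => h (isFace_of_faceDefect_eq_zero fun j =>
    (Finset.sum_eq_zero_iff_of_nonneg fun j _ => faceDefect_nonneg C D j).1 h0 j
      (Finset.mem_univ j))
  have h3 : Even (∑ j, faceDefect C D j) := Finset.even_sum _ fun j _ => even_faceDefect C D j
  have h4 : 2 ≤ ∑ j, faceDefect C D j := by
    obtain ⟨k, hk⟩ := h3
    omega
  have h5 : (2 : ℝ) ≤ ((∑ j, faceDefect C D j : ℤ) : ℝ) := by exact_mod_cast h4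
  rw [four_mul_dist_center_sq_eq]
  linarith

theorem IsFace.dim_le {C D : GridCell n} (h : C.IsFace D) : C.dim ≤ D.dim := by
  have := h.four_mul_dist_center_sq
  have h1 : (C.dim : ℝ) ≤ D.dim := by nlinarith [sq_nonneg (dist C.center D.center)]
  exact_mod_cast h1

theorem IsFace.eq_of_dim_le {C D : GridCell n} (h : C.IsFace D) (hd : D.dim ≤ C.dim) : C = D := by
  have h1 := h.four_mul_dist_center_sq
  rw [le_antisymm h.dim_le hd, sub_self] at h1
  have h2 : dist C.center D.center = 0 := by
    have : dist C.center D.center ^ 2 = 0 := by linarith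
    exact pow_eq_zero_iff two_ne_zero |>.1 this
  exact center_injective (dist_eq_zero.1 h2)

theorem IsFace.refl (C : GridCell n) : C.IsFace C := subset_rfl

theorem one_le_dist_center_of_dim_eq_zero {C D : GridCell n} (hC : C.dim = 0) (hD : D.dim = 0)
    (h : C ≠ D) : 1 ≤ dist C.center D.center := by
  have hC' : C.dirs = ∅ := Finset.card_eq_zero.1 hC
  have hD' : D.dirs = ∅ := Finset.card_eq_zero.1 hD
  obtain ⟨j, hj⟩ : ∃ j, C.base j ≠ D.base j := by
    by_contra! h'
    exact h (GridCell.ext (funext h') (hC'.trans hD'.symm))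
  have h1 : (4 : ℤ) ≤ ∑ j, (C.doubledCenter j - D.doubledCenter j) ^ 2 := by
    refine le_trans ?_ (Finset.single_le_sum (fun i _ => sq_nonneg
      (C.doubledCenter i - D.doubledCenter i)) (Finset.mem_univ j))
    simp only [doubledCenter, hC', hD', Finset.notMem_empty, if_false]
    have : 1 ≤ (C.base j - D.base j) ^ 2 := by
      have := sq_nonneg (C.base j - D.base j)
      have h0 : (C.base j - D.base j) ^ 2 ≠ 0 := pow_ne_zero 2 (sub_ne_zero.2 hj)
      omega
    nlinarith
  have h2 : (4 : ℝ) ≤ ((∑ j, (C.doubledCenter j - D.doubledCenter j) ^ 2 : ℤ) : ℝ) := by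
    exact_mod_cast h1
  rw [← GridCell.four_mul_dist_center_sq] at h2
  nlinarith [dist_nonneg (x := C.center) (y := D.center)]

theorem exists_isFace_dim_eq (C : GridCell n) {m : ℕ} (h1 : C.dim ≤ m) (h2 : m ≤ n) :
    ∃ D : GridCell n, D.dim = m ∧ C.IsFace D := by
  obtain ⟨S, hS, hcard⟩ := Finset.exists_superset_card_eq h1 (by simpa using h2)
  refine ⟨⟨C.base, S⟩, hcard, fun x hx => ⟨fun j _ => ?_, fun j hj => hx.2 j fun h => hj (hS h)⟩⟩
  by_cases hj : j ∈ C.dirs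
  · exact hx.1 j hj
  · rw [hx.2 j hj]
    exact ⟨le_rfl, by linarith⟩

theorem exists_vertex_isFace (C : GridCell n) : ∃ v : GridCell n, v.dim = 0 ∧ v.IsFace C := by
  refine ⟨⟨C.base, ∅⟩, rfl, fun x hx => ⟨fun j _ => ?_, fun j _ => hx.2 j (by simp)⟩⟩
  rw [hx.2 j (by simp)]
  exact ⟨le_rfl, by linarith⟩

theorem exists_intermediate {v q : GridCell n} (hv : v.dim = 0) (hq : q.dim = 2)
    (h : v.IsFace q) : ∃ e : GridCell n, e.dim = 1 ∧ v.IsFace e ∧ e.IsFace q := by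
  have hv' : v.dirs = ∅ := Finset.card_eq_zero.1 hv
  obtain ⟨j, hj⟩ : q.dirs.Nonempty := Finset.card_pos.1 (by rw [dim] at hq; omega)
  refine ⟨⟨Function.update q.base j (v.base j), q.dirs.erase j⟩, ?_, fun x hx => ?_,
    fun x hx => ?_⟩
  · rw [dim] at hq ⊢
    rw [Finset.card_erase_of_mem hj, hq]
  · have hxq := h hx
    refine ⟨fun i hi => ?_, fun i hi => ?_⟩
    · obtain ⟨h1, h2⟩ := Finset.mem_erase.1 hi
      simpa [Function.update_of_ne h1] using hxq.1 i h2
    · by_cases hij : i = j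
      · subst hij
        simpa using hx.2 i (by simp [hv'])
      · have : i ∉ q.dirs := fun h' => hi (Finset.mem_erase.2 ⟨hij, h'⟩)
        simpa [Function.update_of_ne hij] using hxq.2 i this
  · have hvq := h v.center_mem_carrier
    refine ⟨fun i hi => ?_, fun i hi => ?_⟩
    · by_cases hij : i = j
      · subst hij
        have h1 := hx.2 i (by simp)
        have h2 := hvq.1 i hi
        rw [center_apply, hv'] at h2
        simp only [Function.update_self] at h1
        rw [h1]
        simpa using h2
      · simpa [Function.update_of_ne hij] using hx.1 i (Finset.mem_erase.2 ⟨hij, hi⟩)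
    · have hij : i ≠ j := by
        rintro rfl
        exact hi hj
      simpa [Function.update_of_ne hij] using hx.2 i (by simp [hi])

theorem exists_top_of_isChain {c : Set (GridCell n)} (hfin : c.Finite) (hne : c.Nonempty)
    (hc : IsChain IsFace c) : ∃ T ∈ c, ∀ C ∈ c, C.IsFace T := by
  obtain ⟨T, hT, hmax⟩ := c.exists_max_image dim hfin hne
  refine ⟨T, hT, fun C hC => ?_⟩
  rcases eq_or_ne C T with rfl | h
  · exact IsFace.refl C
  rcases hc hC hT h with h' | h'
  · exact h'
  · exact absurd (h'.eq_of_dim_le (hmax C hC)).symm h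

theorem exists_bot_of_isChain {c : Set (GridCell n)} (hfin : c.Finite) (hne : c.Nonempty)
    (hc : IsChain IsFace c) : ∃ L ∈ c, ∀ C ∈ c, L.IsFace C := by
  obtain ⟨L, hL, hmin⟩ := c.exists_min_image dim hfin hne
  refine ⟨L, hL, fun C hC => ?_⟩
  rcases eq_or_ne C L with rfl | h
  · exact IsFace.refl C
  rcases hc hC hL h with h' | h'
  · exact absurd (h'.eq_of_dim_le (hmin C hC)) h
  · exact h'

/-- A chain of cells of dimension at most `2` is part of a chain of a vertex, an edge and a
square of the cubulation. -/
theorem exists_flag (hn : 2 ≤ n) {c : Set (GridCell n)} (hfin : c.Finite) (hne : c.Nonempty)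
    (hc : IsChain IsFace c) (hdim : ∀ C ∈ c, C.dim ≤ 2) :
    ∃ v e q : GridCell n, v.dim = 0 ∧ e.dim = 1 ∧ q.dim = 2 ∧ v.IsFace e ∧ e.IsFace q ∧
      ∀ C ∈ c, C = v ∨ C = e ∨ C = q := by
  obtain ⟨T, hT, htop⟩ := exists_top_of_isChain hfin hne hc
  obtain ⟨L, hL, hbot⟩ := exists_bot_of_isChain hfin hne hc
  obtain ⟨q, hq, hTq⟩ := T.exists_isFace_dim_eq (hdim T hT) hn
  obtain ⟨v, hv, hvL⟩ := L.exists_vertex_isFace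
  have h0 : ∀ C ∈ c, C.dim = 0 → C = v := fun C hC h =>
    (IsFace.eq_of_dim_le (hvL.trans (hbot C hC)) (by omega)).symm
  have h2 : ∀ C ∈ c, C.dim = 2 → C = q := fun C hC h =>
    IsFace.eq_of_dim_le ((htop C hC).trans hTq) (by omega)
  obtain ⟨e, he, hve, heq, h1⟩ : ∃ e : GridCell n, e.dim = 1 ∧ v.IsFace e ∧ e.IsFace q ∧
      ∀ C ∈ c, C.dim = 1 → C = e := by
    by_cases hex : ∃ E ∈ c, E.dim = 1
    · obtain ⟨E, hE, hE1⟩ := hex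
      refine ⟨E, hE1, hvL.trans (hbot E hE), (htop E hE).trans hTq, fun C hC hC1 => ?_⟩
      by_contra hne
      rcases hc hC hE hne with h | h
      · exact hne (IsFace.eq_of_dim_le h (by omega))
      · exact hne (IsFace.eq_of_dim_le h (by omega)).symm
    · push Not at hex
      obtain ⟨e, he, hve, heq⟩ := exists_intermediate hv hq
        (hvL.trans ((hbot T hT).trans hTq))
      exact ⟨e, he, hve, heq, fun C hC h => absurd h (hex C hC)⟩
  refine ⟨v, e, q, hv, he, hq, hve, heq, fun C hC => ?_⟩
  have := hdim C hC
  interval_cases hd : C.dim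
  · exact Or.inl (h0 C hC hd)
  · exact Or.inr (Or.inl (h1 C hC hd))
  · exact Or.inr (Or.inr (h2 C hC hd))

end

end GridCell

theorem CubicalSubcomplex.finite_cells {n : ℕ} (K : CubicalSubcomplex n)
    (h : IsCompact K.support) : K.cells.Finite := by
  obtain ⟨R, hR⟩ := h.isBounded.subset_closedBall 0
  have hfin : (Set.univ.pi fun _ : Fin n => Icc (-(⌈R⌉ + 1)) (⌈R⌉ + 1)).Finite :=
    Set.Finite.pi fun _ => finite_Icc _ _
  refine ((hfin.prod (finite_univ (α := Finset (Fin n)))).image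
    fun p => (⟨p.1, p.2⟩ : GridCell n)).subset fun C hC => ⟨(C.base, C.dirs), ⟨?_, mem_univ _⟩, rfl⟩
  intro j _
  have h1 : C.center ∈ K.support := mem_biUnion hC C.center_mem_carrier
  have h2 := hR h1
  rw [mem_closedBall_zero_iff] at h2
  have h3 := (PiLp.norm_apply_le C.center j).trans h2
  rw [Real.norm_eq_abs, abs_le, GridCell.center_apply] at h3
  have h4 := Int.le_ceil R
  have h5 : (0 : ℝ) ≤ (if j ∈ C.dirs then 1 / 2 else 0) ∧
      (if j ∈ C.dirs then (1 / 2 : ℝ) else 0) ≤ 1 := by split_ifs <;> norm_num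
  constructor
  · have : (-(⌈R⌉ + 1) : ℝ) ≤ C.base j := by linarith [h3.1]
    exact_mod_cast this
  · have : (C.base j : ℝ) ≤ ⌈R⌉ + 1 := by linarith [h3.2]
    exact_mod_cast this

/-! ### The radii and the balls -/

/-- Radii for balls around the vertices, edge midpoints and square centers of the cubulation, and
the coefficients of a point in the common intersection of the balls of a flag. The equations say
that the spheres of incident cells meet at the angles `π/2`, `π/3` and `π/4`. -/
theorem exists_radii : ∃ a b c s t : ℝ, 0 < a ∧ 0 < b ∧ 0 < c ∧ a < 0.44 ∧ b < 0.26 ∧ c < 0.34 ∧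
    a ^ 2 + b ^ 2 = 1 / 4 ∧ b ^ 2 + c ^ 2 + b * c = 1 / 4 ∧
    a ^ 2 + c ^ 2 + √2 * a * c = 1 / 2 ∧ s ^ 2 + t ^ 2 < 4 * a ^ 2 ∧
    (s - 1) ^ 2 + t ^ 2 < 4 * b ^ 2 ∧ (s - 1) ^ 2 + (t - 1) ^ 2 < 4 * c ^ 2 := by
  have r0 : (0 : ℝ) ≤ √2 := Real.sqrt_nonneg 2
  have r1 : √2 ^ 2 = (2 : ℝ) := Real.sq_sqrt (by norm_num)
  have r2 : (1.414 : ℝ) < √2 := by nlinarith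
  have r3 : √2 < (1.415 : ℝ) := by nlinarith
  -- the equations determine the ratio `c / a` up to finitely many values
  obtain ⟨u, ⟨hu1, hu2⟩, hu⟩ : ∃ u ∈ Icc (0.75 : ℝ) 0.77,
      u ^ 4 - √2 * u ^ 3 - 3 * u ^ 2 + 2 = 0 := by
    have hcont : ContinuousOn (fun u : ℝ => u ^ 4 - √2 * u ^ 3 - 3 * u ^ 2 + 2)
        (Icc (0.75 : ℝ) 0.77) := by fun_prop
    have := intermediate_value_Icc' (by norm_num) hcont
    exact this ⟨by norm_num; nlinarith, by norm_num; nlinarith⟩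
  have hu0 : 0 < u := by linarith
  have huu1 : (0.5625 : ℝ) ≤ u ^ 2 := by nlinarith
  have huu2 : u ^ 2 ≤ (0.5929 : ℝ) := by nlinarith
  set D := 2 * (1 + u ^ 2 + √2 * u) with hD
  have hD1 : 5.24 < D := by nlinarith
  have hD2 : D < 5.37 := by nlinarith
  have hD0 : 0 < D := by linarith
  set a := √(1 / D) with ha
  have ha2 : a ^ 2 = 1 / D := Real.sq_sqrt (by positivity)
  have ha0 : 0 < a := Real.sqrt_pos.2 (by positivity)
  have haD : a ^ 2 * D = 1 := by rw [ha2]; field_simp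
  have hA1 : (0.186 : ℝ) < a ^ 2 := by
    rw [ha2, lt_div_iff₀ hD0]
    linarith
  have hA2 : a ^ 2 < (0.191 : ℝ) := by
    rw [ha2, div_lt_iff₀ hD0]
    linarith
  have hu21 : 0 < 1 - u ^ 2 := by linarith
  obtain ⟨b, hb⟩ : ∃ b, b = a * (1 - u ^ 2) / u := ⟨_, rfl⟩
  have hbu : b * u = a * (1 - u ^ 2) := by rw [hb]; field_simp
  have hb0 : 0 < b := by rw [hb]; positivity
  have e1 : a ^ 2 + b ^ 2 = 1 / 4 := by
    have h1 : (a ^ 2 + b ^ 2) * u ^ 2 = a ^ 2 * (u ^ 2 + (1 - u ^ 2) ^ 2) := by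
      have : b ^ 2 * u ^ 2 = a ^ 2 * (1 - u ^ 2) ^ 2 := by rw [← mul_pow, hbu, mul_pow]
      linarith
    have h2 : 4 * (u ^ 2 + (1 - u ^ 2) ^ 2) = D * u ^ 2 := by
      rw [hD]
      linear_combination 2 * hu
    have h3 : (a ^ 2 + b ^ 2 - 1 / 4) * u ^ 2 = 0 := by
      linear_combination h1 + a ^ 2 / 4 * h2 + u ^ 2 / 4 * haD
    have := (mul_eq_zero.1 h3).resolve_right (by positivity)
    linarith
  have hc2 : (u * a) ^ 2 = u ^ 2 * a ^ 2 := by ring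
  have e2 : b ^ 2 + (u * a) ^ 2 + b * (u * a) = 1 / 4 := by
    linear_combination e1 + a * hbu
  have e3 : a ^ 2 + (u * a) ^ 2 + √2 * a * (u * a) = 1 / 2 := by
    rw [hD] at haD
    linear_combination haD / 2
  have hc1 : (0.104 : ℝ) < (u * a) ^ 2 := by
    rw [hc2]
    calc (0.104 : ℝ) < 0.5625 * 0.186 := by norm_num
      _ ≤ u ^ 2 * a ^ 2 := by gcongr
  have hc3 : (u * a) ^ 2 < (0.1135 : ℝ) := by
    rw [hc2]
    calc u ^ 2 * a ^ 2 ≤ 0.5929 * 0.191 := by gcongr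
      _ < 0.1135 := by norm_num
  refine ⟨a, b, u * a, 0.757, 0.405, ha0, hb0, by positivity, ?_, ?_, ?_, e1, e2, e3, ?_, ?_, ?_⟩
  · exact lt_of_pow_lt_pow_left₀ 2 (by norm_num) (by norm_num; linarith)
  · exact lt_of_pow_lt_pow_left₀ 2 (by norm_num) (by norm_num; linarith)
  · exact lt_of_pow_lt_pow_left₀ 2 (by norm_num) (by norm_num; linarith)
  · norm_num; linarith
  · norm_num; linarith
  · norm_num; linarith

/-- The radius of the ball around the center of a cell of the given dimension (at most `2`). -/
def cellRadius (a b c : ℝ) : ℕ → ℝ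
  | 0 => a
  | 1 => b
  | _ => c

/-- A family of balls centered at the centers of distinct cells of dimension at most `2`, any two of
which have disjoint closures or belong to incident cells, such that the spheres of incident cells
meet at angles `π/m` and the balls of the cells of a flag have a common point. -/
structure IsBarycentricFamily {ι : Type*} (cell : ι → GridCell 4) (B : ι → RoundBall) : Prop where
  injective : Function.Injective cell
  dim_le : ∀ i, (cell i).dim ≤ 2
  center : ∀ i, (B i).center = (cell i).center
  add_lt : ∀ i j, i ≠ j → ¬ (cell i).IsFace (cell j) → ¬ (cell j).IsFace (cell i) →
    (B i).radius + (B j).radius < dist (B i).center (B j).center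
  angle : ∀ i j, i ≠ j → (cell i).IsFace (cell j) → ∃ m : ℕ, 2 ≤ m ∧
    lorentzForm (B i).normal (B j).normal = -Real.cos (Real.pi / m)
  flag : ∀ v e q : GridCell 4, v.dim = 0 → e.dim = 1 → q.dim = 2 → v.IsFace e → e.IsFace q →
    ∃ x : E4, ∀ i, cell i = v ∨ cell i = e ∨ cell i = q → x ∈ (B i).ball

theorem cellRadius_add_lt {a b c : ℝ} (ha : 0 < a) (hb : 0 < b) (hc : 0 < c) (ha' : a < 0.44)
    (hb' : b < 0.26) (hc' : c < 0.34) {C D : GridCell 4} (hCD : C.dim ≤ D.dim) (hD : D.dim ≤ 2)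
    (hne : C ≠ D) (h : ¬ C.IsFace D) :
    cellRadius a b c C.dim + cellRadius a b c D.dim < dist C.center D.center := by
  have h1 := GridCell.le_four_mul_dist_center_sq h
  have hd := dist_nonneg (x := C.center) (y := D.center)
  by_cases hD0 : D.dim = 0
  · have hC0 : C.dim = 0 := by omega
    have := GridCell.one_le_dist_center_of_dim_eq_zero hC0 hD0 hne
    rw [hC0, hD0]
    simp only [cellRadius]
    linarith
  · refine lt_of_pow_lt_pow_left₀ 2 hd ?_
    have key : ∀ r : ℝ, ∀ p k : ℝ, 0 ≤ r → r ≤ p → 4 * p ^ 2 < k →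
        k ≤ 4 * dist C.center D.center ^ 2 → r ^ 2 < dist C.center D.center ^ 2 := by
      intro r p k h0 h1 h2 h3
      nlinarith
    obtain ⟨hC, hD'⟩ | ⟨hC, hD'⟩ | ⟨hC, hD'⟩ | ⟨hC, hD'⟩ | ⟨hC, hD'⟩ :
        (C.dim = 0 ∧ D.dim = 1) ∨ (C.dim = 0 ∧ D.dim = 2) ∨ (C.dim = 1 ∧ D.dim = 1) ∨
        (C.dim = 1 ∧ D.dim = 2) ∨ (C.dim = 2 ∧ D.dim = 2) := by omega
    all_goals
      rw [hC, hD'] at h1 ⊢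
      simp only [cellRadius]
    · exact key _ 0.7 3 (by linarith) (by linarith) (by norm_num) (by norm_num at h1; linarith)
    · exact key _ 0.78 4 (by linarith) (by linarith) (by norm_num) (by push_cast at h1; linarith)
    · exact key _ 0.52 2 (by linarith) (by linarith) (by norm_num) (by norm_num at h1; linarith)
    · exact key _ 0.6 3 (by linarith) (by linarith) (by norm_num) (by norm_num at h1; linarith)
    · exact key _ 0.68 2 (by linarith) (by linarith) (by norm_num) (by norm_num at h1; linarith)

/-- Two perpendicular steps of length `1/2` lead from a vertex to the center of an edge and on to
the center of a square. -/
theorem exists_mem_flag_balls {a b c s t : ℝ} (ha : 0 < a) (hb : 0 < b) (hc : 0 < c)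
    (h1 : s ^ 2 + t ^ 2 < 4 * a ^ 2) (h2 : (s - 1) ^ 2 + t ^ 2 < 4 * b ^ 2)
    (h3 : (s - 1) ^ 2 + (t - 1) ^ 2 < 4 * c ^ 2) {v e q : GridCell 4} (hv : v.dim = 0)
    (he : e.dim = 1) (hq : q.dim = 2) (hve : v.IsFace e) (heq : e.IsFace q) :
    ∃ x : E4, dist x v.center < a ∧ dist x e.center < b ∧ dist x q.center < c := by
  have d1 := hve.four_mul_dist_center_sq
  have d2 := heq.four_mul_dist_center_sq
  have d3 := GridCell.IsFace.four_mul_dist_center_sq (show v.IsFace q from hve.trans heq)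
  rw [hv, he, dist_comm, dist_eq_norm] at d1
  rw [he, hq, dist_comm, dist_eq_norm] at d2
  rw [hv, hq, dist_comm, dist_eq_norm] at d3
  obtain ⟨p, hp⟩ : ∃ p, p = e.center - v.center := ⟨_, rfl⟩
  obtain ⟨r, hr⟩ : ∃ r, r = q.center - e.center := ⟨_, rfl⟩
  have hpr : q.center - v.center = p + r := by rw [hp, hr]; abel
  rw [← hp] at d1
  rw [← hr] at d2
  rw [hpr, norm_add_sq_real] at d3
  norm_num at d1 d2 d3
  have hin : inner ℝ p r = 0 := by linarith
  have hnorm : ∀ α β : ℝ, ‖α • p + β • r‖ ^ 2 = (α ^ 2 + β ^ 2) / 4 := by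
    intro α β
    rw [norm_add_sq_real, norm_smul, norm_smul, inner_smul_left, inner_smul_right, hin, mul_pow,
      mul_pow, Real.norm_eq_abs, Real.norm_eq_abs, sq_abs, sq_abs]
    simp only [conj_trivial]
    linear_combination α ^ 2 / 4 * d1 + β ^ 2 / 4 * d2
  have key : ∀ y z : E4, ∀ α β ρ : ℝ, 0 < ρ → y - z = α • p + β • r →
      α ^ 2 + β ^ 2 < 4 * ρ ^ 2 → dist y z < ρ := by
    intro y z α β ρ hρ hyz hlt
    rw [dist_eq_norm, hyz]
    refine lt_of_pow_lt_pow_left₀ 2 hρ.le ?_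
    rw [hnorm]
    linarith
  refine ⟨v.center + (s • p + t • r), key _ _ s t a ha (by abel) h1,
    key _ _ (s - 1) t b hb ?_ h2, key _ _ (s - 1) (t - 1) c hc ?_ h3⟩
  · have : e.center = v.center + p := by rw [hp]; abel
    rw [this]
    module
  · have : q.center = v.center + (p + r) := by rw [← hpr]; abel
    rw [this]
    module

theorem exists_isBarycentricFamily {ι : Type*} (cell : ι → GridCell 4)
    (hinj : Function.Injective cell) (hdim : ∀ i, (cell i).dim ≤ 2) :
    ∃ B : ι → RoundBall, IsBarycentricFamily cell B := by
  obtain ⟨a, b, c, s, t, ha, hb, hc, ha', hb', hc', e1, e2, e3, f1, f2, f3⟩ := exists_radii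
  have hpos : ∀ k, 0 < cellRadius a b c k := fun k => by
    match k with
    | 0 => exact ha
    | 1 => exact hb
    | _ + 2 => exact hc
  refine ⟨fun i => ⟨(cell i).center, cellRadius a b c (cell i).dim, hpos _⟩, hinj, hdim,
    fun i => rfl, fun i j hij h1 h2 => ?_, fun i j hij h => ?_, fun v e q hv he hq hve heq => ?_⟩
  · rcases le_total (cell i).dim (cell j).dim with h | h
    · exact cellRadius_add_lt ha hb hc ha' hb' hc' h (hdim j) (hinj.ne hij) h1
    · have := cellRadius_add_lt ha hb hc ha' hb' hc' h (hdim i) (hinj.ne hij.symm) h2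
      rwa [add_comm, dist_comm] at this
  · have hlt : (cell i).dim < (cell j).dim := by
      by_contra! hge
      exact hij (hinj (h.eq_of_dim_le hge))
    have hj := hdim j
    have hd := h.four_mul_dist_center_sq
    rw [RoundBall.lorentzForm_normal]
    obtain ⟨hC, hD⟩ | ⟨hC, hD⟩ | ⟨hC, hD⟩ : ((cell i).dim = 0 ∧ (cell j).dim = 1) ∨
        ((cell i).dim = 0 ∧ (cell j).dim = 2) ∨ ((cell i).dim = 1 ∧ (cell j).dim = 2) := by omega
    all_goals
      rw [hC, hD] at hd
      norm_num at hd
      simp only [hC, hD, cellRadius]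
    · refine ⟨2, le_rfl, ?_⟩
      rw [show a ^ 2 + b ^ 2 - dist (cell i).center (cell j).center ^ 2 = 0 by linarith]
      simp
    · refine ⟨4, by norm_num, ?_⟩
      push_cast
      rw [Real.cos_pi_div_four, show a ^ 2 + c ^ 2 - dist (cell i).center (cell j).center ^ 2 =
        -(√2 * a * c) by linarith]
      field_simp
    · refine ⟨3, by norm_num, ?_⟩
      push_cast
      rw [Real.cos_pi_div_three, show b ^ 2 + c ^ 2 - dist (cell i).center (cell j).center ^ 2 =
        -(b * c) by linarith]
      field_simp
  · obtain ⟨x, x1, x2, x3⟩ := exists_mem_flag_balls ha hb hc f1 f2 f3 hv he hq hve heq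
    refine ⟨x, fun i hi => ?_⟩
    rcases hi with hi | hi | hi
    all_goals
      simp only [RoundBall.ball, Metric.mem_ball, hi, hv, he, hq]
      assumption

namespace IsBarycentricFamily

variable {ι : Type*} {cell : ι → GridCell 4} {B : ι → RoundBall}

theorem isCoxeterSystemOfNormals (h : IsBarycentricFamily cell B) :
    IsCoxeterSystemOfNormals lorentzForm fun i => (B i).normal where
  symm := lorentzForm_symm
  unit i := (B i).lorentzForm_normal_self
  angle i j hij := by
    by_cases h1 : (cell i).IsFace (cell j)
    · exact Or.inr (h.angle i j hij h1)
    by_cases h2 : (cell j).IsFace (cell i)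
    · obtain ⟨m, hm, hm'⟩ := h.angle j i hij.symm h2
      exact Or.inr ⟨m, hm, by rw [lorentzForm_symm, hm']⟩
    · left
      have h3 := h.add_lt i j hij h1 h2
      have hi := (B i).radius_pos
      have hj := (B j).radius_pos
      rw [RoundBall.lorentzForm_normal, div_le_iff₀ (by positivity)]
      nlinarith

theorem isChain_of_dist_le (h : IsBarycentricFamily cell B) {J : Set ι} {x : E4}
    (hx : ∀ i ∈ J, dist x (B i).center ≤ (B i).radius) : IsChain GridCell.IsFace (cell '' J) := by
  rintro _ ⟨i, hi, rfl⟩ _ ⟨j, hj, rfl⟩ hne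
  by_contra! hcon
  have h1 := h.add_lt i j (fun hij => hne (congrArg cell hij)) hcon.1 hcon.2
  linarith [hx i hi, hx j hj, dist_triangle_left (B i).center (B j).center x]

/-- The centers of the cells of a chain agree in some coordinate. Moving in this coordinate away
from them, one leaves all the balls whose boundaries contain a given point. -/
theorem exteriorDomain_subset_closure_interior [Finite ι] (h : IsBarycentricFamily cell B) :
    exteriorDomain B ⊆ closure (interior (exteriorDomain B)) := by
  intro p hp
  induction p using OnePoint.rec with
  | infty => exact subset_closure infty_mem_interior_exteriorDomain
  | coe x =>
    have hout : ∀ i, (B i).radius ≤ dist x (B i).center := by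
      intro i
      by_contra! hlt
      exact hp (mem_iUnion.2 ⟨i, x, hlt, rfl⟩)
    set J := {i | dist x (B i).center = (B i).radius} with hJ
    have hchain := h.isChain_of_dist_le (J := J) (x := x) fun i hi => le_of_eq hi
    obtain ⟨d, y, hy⟩ : ∃ (d : Fin 4) (y : ℝ), ∀ i ∈ J, (B i).center d = y := by
      rcases J.eq_empty_or_nonempty with h0 | hne
      · exact ⟨0, 0, by simp [h0]⟩
      obtain ⟨T, ⟨k, hk, rfl⟩, htop⟩ :=
        GridCell.exists_top_of_isChain (toFinite (cell '' J)) (hne.image cell) hchain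
      obtain ⟨d, hd⟩ : ∃ d, d ∉ (cell k).dirs := by
        by_contra! hall
        have h1 : (cell k).dim = 4 := by
          rw [GridCell.dim, Finset.eq_univ_iff_forall.2 hall]
          simp
        have := h.dim_le k
        omega
      refine ⟨d, (cell k).base d, fun i hi => ?_⟩
      rw [h.center]
      exact (htop _ ⟨i, hi, rfl⟩ (cell i).center_mem_carrier).2 d hd
    obtain ⟨σ, hσ, hσx⟩ : ∃ σ : ℝ, σ ^ 2 = 1 ∧ 0 ≤ σ * (x d - y) := by
      rcases le_total y (x d) with h1 | h1
      · exact ⟨1, by norm_num, by linarith⟩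
      · exact ⟨-1, by norm_num, by linarith⟩
    set u : E4 := EuclideanSpace.single d σ with hu
    have hu2 : ‖u‖ ^ 2 = 1 := by
      rw [hu, PiLp.norm_single, Real.norm_eq_abs, sq_abs, hσ]
    have hcont : Continuous fun t : ℝ => x + t • u := by fun_prop
    have htend : Tendsto (fun t : ℝ => ((x + t • u : E4) : S4)) (𝓝[>] 0) (𝓝 (x : S4)) := by
      have := (OnePoint.continuous_coe.comp hcont).tendsto 0
      simp only [Function.comp_apply, zero_smul, add_zero] at this
      exact this.mono_left nhdsWithin_le_nhds
    refine mem_closure_of_tendsto htend ?_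
    simp only [mem_interior_exteriorDomain, RoundBall.lorentzForm_lightCone_normal_neg,
      OnePoint.coe_injective.mem_set_image, Metric.mem_closedBall, not_le]
    rw [eventually_all]
    intro i
    by_cases hi : i ∈ J
    · filter_upwards [self_mem_nhdsWithin] with t ht
      refine lt_of_pow_lt_pow_left₀ 2 dist_nonneg ?_
      have hi' : dist x (B i).center = (B i).radius := hi
      rw [← hi', dist_eq_norm, dist_eq_norm,
        show x + t • u - (B i).center = (x - (B i).center) + t • u by abel, norm_add_sq_real,
        norm_smul, mul_pow, hu2, inner_smul_right, hu, EuclideanSpace.inner_single_right]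
      simp only [PiLp.sub_apply, hy i hi, conj_trivial, Real.norm_eq_abs, sq_abs]
      have ht0 : 0 < t := ht
      nlinarith [mul_nonneg ht0.le hσx, mul_pos ht0 ht0]
    · have hlt : (B i).radius < dist (x + (0 : ℝ) • u) (B i).center := by
        rw [zero_smul, add_zero]
        exact lt_of_le_of_ne (hout i) (Ne.symm hi)
      exact nhdsWithin_le_nhds
        ((hcont.dist continuous_const).continuousAt.eventually_const_lt hlt)

end IsBarycentricFamily

/-! ### The nerve -/

namespace IsBarycentricFamily

variable {ι : Type*} {cell : ι → GridCell 4} {B : ι → RoundBall}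

theorem mem_nerve_iff (h : IsBarycentricFamily cell B) (s : Finset ι) :
    s ∈ (nerve B).faces ↔
      s.Nonempty ∧ IsChain GridCell.IsFace (cell '' (s : Set ι)) := by
  constructor
  · rintro ⟨hne, x, hx⟩
    refine ⟨hne, h.isChain_of_dist_le (x := x) fun i hi => ?_⟩
    exact (Metric.mem_ball.1 (mem_iInter₂.1 hx i hi)).le
  · rintro ⟨hne, hc⟩
    obtain ⟨v, e, q, hv, he, hq, hve, heq, hmem⟩ := GridCell.exists_flag (by norm_num)
      (s.finite_toSet.image cell) (hne.to_set.image cell) hc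
      (by rintro _ ⟨i, -, rfl⟩; exact h.dim_le i)
    obtain ⟨x, hx⟩ := h.flag v e q hv he hq hve heq
    exact ⟨hne, x, mem_iInter₂.2 fun i hi => hx i (hmem _ ⟨i, hi, rfl⟩)⟩

theorem isSimplicialIsoOnto [Fintype ι] (h : IsBarycentricFamily cell B)
    (K : CubicalSubcomplex 4) (hK : range cell = K.cells) :
    IsSimplicialIsoOnto (nerve B) (fun i => (B i).center) K.barycentricSubdivision := by
  classical
  have hcen : (fun i => (B i).center) = fun i => (cell i).center := funext h.center
  rw [hcen]
  let E : ι ↪ GridCell 4 := ⟨cell, h.injective⟩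
  have hface : ∀ s : Finset ι, s ∈ (nerve B).faces ↔
      (s.map E).map GridCell.centerEmb ∈ K.barycentricSubdivision.faces := by
    intro s
    rw [h.mem_nerve_iff]
    constructor
    · rintro ⟨hne, hc⟩
      refine ⟨s.map E, hne.map, ?_, ?_, rfl⟩
      · rw [← hK, Finset.coe_map]
        exact image_subset_range _ _
      · rwa [Finset.coe_map]
    · rintro ⟨c, hne, -, hc, hs⟩
      have := Finset.map_injective _ hs
      subst this
      rw [Finset.coe_map] at hc
      exact ⟨Finset.map_nonempty.1 hne, hc⟩
  have hfaces : ∀ t ∈ K.barycentricSubdivision.faces,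
      ∃ s : Finset ι, t = (s.map E).map GridCell.centerEmb := by
    rintro t ⟨c, hne, hcK, hc, rfl⟩
    refine ⟨c.preimage cell h.injective.injOn, ?_⟩
    congr 1
    rw [← Finset.coe_inj, Finset.coe_map, Finset.coe_preimage]
    exact (image_preimage_eq_of_subset (hK ▸ hcK)).symm
  have hcoe : ∀ s : Finset ι, (((s.map E).map GridCell.centerEmb : Finset E4) : Set E4) =
      (fun i => (cell i).center) '' s := by
    intro s
    rw [Finset.coe_map, Finset.coe_map, image_image]
    rfl
  have hcinj : Function.Injective fun i => (cell i).center :=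
    GridCell.center_injective.comp h.injective
  refine ⟨⟨fun i hi => ?_, hcinj.injOn, fun x hx => ?_⟩, fun s => ⟨fun hs => ?_, ?_⟩,
    fun w hw => ?_, fun w hw w' hw' heq => ?_, fun x hx => ?_⟩
  · have := (hface {i}).1 hi
    rwa [Finset.map_singleton, Finset.map_singleton] at this
  · obtain ⟨s, hs⟩ := hfaces {x} hx
    have hs' : s ∈ (nerve B).faces := (hface s).2 (hs ▸ hx)
    obtain ⟨i, rfl⟩ : ∃ i, s = {i} := Finset.card_eq_one.1 (by
      have := congrArg Finset.card hs
      simpa using this.symm)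
    refine ⟨i, hs', ?_⟩
    rw [Finset.map_singleton, Finset.map_singleton, Finset.singleton_inj] at hs
    exact hs.symm
  · exact ⟨_, (hface s).1 hs, hcoe s⟩
  · rintro ⟨t, ht, hts⟩
    rw [hface]
    convert ht
    rw [← Finset.coe_inj, hcoe, hts]
  · obtain ⟨⟨hw0, hw1⟩, s, hs, hsw⟩ := hw
    refine Geometry.SimplicialComplex.convexHull_subset_space ((hface s).1 hs) ?_
    rw [hcoe, linearExtension, ← Finset.sum_subset (Finset.subset_univ s) fun i _ hi => by
      rw [not_not.1 (mt (hsw i).2 hi), zero_smul]]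
    refine (convex_convexHull ℝ _).sum_mem (fun i _ => hw0 i) ?_ fun i hi =>
      subset_convexHull ℝ _ ⟨i, hi, rfl⟩
    rw [← hw1]
    exact Finset.sum_subset (Finset.subset_univ s) fun i _ hi => not_not.1 (mt (hsw i).2 hi)
  · -- barycentric coordinates with respect to chains of cells are unique
    have ext : ∀ w ∈ realization (nerve B), ∃ s : Finset ι,
        IsChain GridCell.IsFace (s.map E : Set (GridCell 4)) ∧
        (∀ C ∈ s.map E, 0 ≤ Function.extend cell w 0 C) ∧
        (∀ C ∉ s.map E, Function.extend cell w 0 C = 0) ∧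
        ∑ C ∈ s.map E, Function.extend cell w 0 C = 1 ∧
        ∑ C ∈ s.map E, Function.extend cell w 0 C • C.center =
          linearExtension (fun i => (cell i).center) w := by
      rintro w ⟨⟨hw0, hw1⟩, s, hs, hsw⟩
      have hE : ∀ i, Function.extend cell w 0 (E i) = w i := fun i =>
        h.injective.extend_apply w 0 i
      have hz : ∀ i ∉ s, w i = 0 := fun i hi => not_not.1 (mt (hsw i).2 hi)
      refine ⟨s, ?_, fun C hC => ?_, fun C hC => ?_, ?_, ?_⟩
      · rw [Finset.coe_map]
        exact ((h.mem_nerve_iff s).1 hs).2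
      · obtain ⟨i, -, rfl⟩ := Finset.mem_map.1 hC
        rw [hE]
        exact hw0 i
      · by_cases hC' : ∃ i, cell i = C
        · obtain ⟨i, rfl⟩ := hC'
          rw [h.injective.extend_apply]
          exact hz i fun hi => hC (Finset.mem_map_of_mem E hi)
        · rw [Function.extend_apply' _ _ _ hC']
          rfl
      · rw [Finset.sum_map, ← hw1]
        simp only [hE]
        exact Finset.sum_subset (Finset.subset_univ s) fun i _ hi => hz i hi
      · rw [Finset.sum_map, linearExtension]
        simp only [hE]
        exact Finset.sum_subset (Finset.subset_univ s) fun i _ hi => by rw [hz i hi, zero_smul]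
    obtain ⟨s, a1, a2, a3, a4, a5⟩ := ext w hw
    obtain ⟨s', b1, b2, b3, b4, b5⟩ := ext w' hw'
    have key := CubicalSubcomplex.chain_weights_unique a1 b1 _ _ a2 b2 a3 b3 (a4.trans b4.symm)
      (a5.trans (heq.trans b5.symm))
    funext i
    have := key (cell i)
    rwa [h.injective.extend_apply, h.injective.extend_apply] at this
  · obtain ⟨t, ht, hxt⟩ := Geometry.SimplicialComplex.mem_space_iff.1 hx
    obtain ⟨s, rfl⟩ := hfaces t ht
    obtain ⟨w, w0, w1, wx⟩ := Finset.mem_convexHull'.1 hxt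
    rw [Finset.sum_map, Finset.sum_map] at w1 wx
    have hw0 : ∀ i ∈ s, 0 ≤ w (cell i).center := fun i hi =>
      w0 _ (Finset.mem_map_of_mem _ (Finset.mem_map_of_mem E hi))
    have hs := ((h.mem_nerve_iff s).1 ((hface s).2 ht)).2
    refine ⟨fun i => if i ∈ s then w (cell i).center else 0, ⟨⟨fun i => ?_, ?_⟩,
      s.filter fun i => w (cell i).center ≠ 0, (h.mem_nerve_iff _).2 ⟨?_, ?_⟩, fun i => ?_⟩, ?_⟩
    · dsimp only
      split_ifs with hi
      · exact hw0 i hi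
      · exact le_rfl
    · rw [Finset.sum_ite_mem, Finset.univ_inter]
      exact w1
    · by_contra hemp
      rw [Finset.not_nonempty_iff_eq_empty, Finset.filter_eq_empty_iff] at hemp
      have : ∑ i ∈ s, w (cell i).center = 0 :=
        Finset.sum_eq_zero fun i hi => not_not.1 (hemp hi)
      exact one_ne_zero (w1.symm.trans this)
    · exact hs.mono (image_mono (Finset.coe_subset.2 (Finset.filter_subset _ _)))
    · simp
    · rw [linearExtension]
      simp only [ite_smul, zero_smul]
      rw [Finset.sum_ite_mem, Finset.univ_inter]
      exact wx

end IsBarycentricFamily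

theorem mainTheorem4 (K : CubicalSubcomplex 4)
    (hdim : ∀ C ∈ K.cells, C.dim ≤ 2)
    (hcompact : IsCompact K.support)
    (hvertex : ∀ v ∈ K.cells, v.dim = 0 → ∃ Q ∈ K.cells, Q.dim = 2 ∧ v.IsFace Q) :
    ∃ (k : ℕ) (B : Fin k → RoundBall),
      (∀ i, (B i).center ∈ K.barycentricSubdivision.vertices) ∧
      IsDiscreteReflectionGroup (Subgroup.closure (range fun i => (B i).inversion)) ∧
      IsKleinianFundamentalDomain (Subgroup.closure (range fun i => (B i).inversion))
        (⋃ i, ((↑) : E4 → S4) '' (B i).ball)ᶜ ∧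
      IsSimplicialIsoOnto (nerve B) (fun i => (B i).center) K.barycentricSubdivision := by
  have := (K.finite_cells hcompact).to_subtype
  obtain ⟨k, ⟨f⟩⟩ := Finite.exists_equiv_fin K.cells
  let cell : Fin k → GridCell 4 := fun i => f.symm i
  have hinj : Function.Injective cell := Subtype.val_injective.comp f.symm.injective
  have hK : range cell = K.cells := by
    change range (Subtype.val ∘ f.symm) = _
    rw [f.symm.surjective.range_comp, Subtype.range_coe]
  obtain ⟨B, hB⟩ := exists_isBarycentricFamily cell hinj fun i => hdim _ (f.symm i).2
  have hiso := hB.isSimplicialIsoOnto K hK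
  refine ⟨k, B, fun i => hiso.vertices.mapsTo ?_,
    hB.isCoxeterSystemOfNormals.isDiscreteReflectionGroup,
    hB.isCoxeterSystemOfNormals.isKleinianFundamentalDomain
      hB.exteriorDomain_subset_closure_interior, hiso⟩
  exact (hB.mem_nerve_iff {i}).2 ⟨Finset.singleton_nonempty i, by simp⟩
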